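/- Let $(E,d)$ be a separable metric space with its Borel $\sigma$-algebra, let $p\ge 1$, and let $\mu$ be a Borel probability measure on $E$ with $\int_E d(x,x_0)^p\,d\mu(x)<\infty$ for some $x_0\in E$, such that $\mu$ is not of the form $\delta_x$ with $x\in E$. For probability measures $\nu_1,\nu_2$ on $E$ let $$W_p(\nu_1,\nu_2)=\inf_\gamma\Big(\int_{E\times E}d(x,y)^p\,d\gamma(x,y)\Big)^{1/p},$$ where the infimum is over all probability measures $\gamma$ on $E\times E$ with marginals $\nu_1$ and $\nu_2$. For $n\ge 1$ let $$b_{n,p}(\mu)=\inf_{x_1,\dots,x_n\in E}W_p\Big(\mu,\frac1n\sum_{i=1}^n\delta_{x_i}\Big)$$ be the optimal uniform quantization error, and let $\mu_n=\frac1n\sum_{i=1}^n\delta_{X_i}$ be the empirical measure of independent samples $X_1,X_2,\dots$ of $\mu$. Then, with the convention $\ln 0=-\infty$ and with upper limits taken in $[-\infty,\infty]$, $$\max\Big(-\frac12,\ \limsup_{n\to\infty}\frac{\ln b_{n,p}(\mu)}{\ln n}\Big)\ \le\ \limsup_{n\to\infty}\frac{\ln\big(\mathbb E[W_p(\mu_n,\mu)^p]\big)^{1/p}}{\ln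 n}\ \le\ \max\Big(-\frac1{2p},\ \limsup_{n\to\infty}\frac{\ln b_{n,p}(\mu)}{\ln n}\Big).$$ Moreover, for every $0\le\beta<\frac1{2p}$, $$\limsup_{n\to\infty}n^\beta\, b_{n,p}(\mu)\ \le\ \limsup_{n\to\infty}n^\beta\big(\mathbb E[W_p(\mu_n,\mu)^p]\big)^{1/p}\ \le\ \frac{10}{\frac1{2p}-\beta}\ \limsup_{n\to\infty}n^\beta\, b_{n,p}(\mu),$$ where the upper limits take values in $[0,\infty]$. -/

import Mathlib

open MeasureTheory ProbabilityTheory Filter Topology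
open scoped ENNReal

/-- `μ` has a finite `p`-th moment: `∫ d(x, x₀)^p dμ(x) < ∞` for some point `x₀`. -/
def HasFiniteMoment {E : Type*} [MetricSpace E] [MeasurableSpace E]
    (p : ℝ) (μ : Measure E) : Prop :=
  ∃ x₀ : E, ∫⁻ x, edist x x₀ ^ p ∂μ < ∞

/-- `γ` is a coupling of `μ` and `ν`: a probability measure on `E × E` with marginals `μ`, `ν`. -/
structure IsCoupling {E : Type*} [MeasurableSpace E]
    (μ ν : Measure E) (γ : Measure (E × E)) : Prop where
  isProbabilityMeasure : IsProbabilityMeasure γ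
  map_fst : γ.map Prod.fst = μ
  map_snd : γ.map Prod.snd = ν

/-- The `p`-Wasserstein distance
`W_p(μ, ν) = inf_γ (∫ d(x, y)^p dγ(x, y))^(1/p)`, with values in `[0, ∞]`. -/
noncomputable def wassersteinDist {E : Type*} [MetricSpace E] [MeasurableSpace E]
    (p : ℝ) (μ ν : Measure E) : ℝ≥0∞ :=
  ⨅ (γ : Measure (E × E)) (_ : IsCoupling μ ν γ), (∫⁻ z, edist z.1 z.2 ^ p ∂γ) ^ (1 / p)

/-- The measure `(1/n) ∑ᵢ δ_{xᵢ}` attached to points `x₁, …, xₙ`. -/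
noncomputable def uniformMeasure {E : Type*} [MeasurableSpace E] {n : ℕ} (x : Fin n → E) :
    Measure E :=
  (n : ℝ≥0∞)⁻¹ • ∑ i, Measure.dirac (x i)

/-- The optimal uniform quantization error
`b_{n,p}(μ) = inf_{x₁, …, xₙ} W_p(μ, (1/n) ∑ᵢ δ_{xᵢ})`. -/
noncomputable def optimalUniformError {E : Type*} [MetricSpace E] [MeasurableSpace E]
    (p : ℝ) (μ : Measure E) (n : ℕ) : ℝ≥0∞ :=
  ⨅ x : Fin n → E, wassersteinDist p μ (uniformMeasure x)

/-- The error `(𝔼[W_p(μₙ, μ)^p])^(1/p)` of the empirical measure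
`μₙ = (1/n) ∑_{i < n} δ_{Xᵢ}`. -/
noncomputable def empiricalError {E Ω : Type*} [MetricSpace E] [MeasurableSpace E]
    [MeasurableSpace Ω] (P : Measure Ω) (X : ℕ → Ω → E) (p : ℝ) (μ : Measure E) (n : ℕ) :
    ℝ≥0∞ :=
  (∫⁻ ω, wassersteinDist p (uniformMeasure fun i : Fin n => X i ω) μ ^ p ∂P) ^ (1 / p)

/-- The upper polynomial exponent `limsup_{n → ∞} ln aₙ / ln n` of a sequence in `[0, ∞]`, an
extended real number; here `ln 0 = -∞`. -/
noncomputable def polynomialExponent (a : ℕ → ℝ≥0∞) : EReal :=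
  limsup (fun n : ℕ => ENNReal.log (a n) / ((Real.log n : ℝ) : EReal)) atTop

/-! The lower bounds are elementary. The empirical measure is itself a uniform `n`-point measure, so
every sample has error at least `b_{n,p}(μ)`. The exponent `-1/2` comes from testing against one
bounded 1-Lipschitz function that is not a.s. constant: its empirical mean fluctuates by `n^(-1/2)`,
by second and fourth moments (`exists_le_expectedError`).

For the upper bound, take near-optimal uniform quantizers with `M 0 = 1 ∣ M 1 ∣ ... ∣ M K` points.
Repeating the points of level `k` makes it a uniform measure on `M (k+1)` labels; Birkhoff's theorem
then matches it with level `k+1` by a permutation, at cost at most `b k + b (k+1)`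
(`exists_perm_le_wassersteinDist_add`). After relabelling, the points form a tree in which the
ancestor of leaf `i` at level `k` is given by `i % M k`, and the `L^p` distance from leaf to
ancestor is at most the sum of the later costs.

Replacing `μ` by the measure on the leaves costs twice its quantization error
(`expectedError_le_add`). A sample of leaves is a sample of uniform labels. Between the uniform
weights and the empirical weights interpolate the weights that record only label counts modulo `M
k`. Consecutive levels give equal mass to each coarse class, so mass moves only inside classes,
through the ancestor; the expected amount is of order `√(M (k+1) / n)`. Summing over levels gives
`expectedError_le_sum`, in which scale `m` contributes about `(m/n)^(1/(2p)) b_{m,p}(μ)`.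

If `b_{m,p}(μ) ≤ C m^(-β)` with `β < 1/(2p)`, these contributions grow geometrically along `m = m₀
r^j` up to `m ≈ n`, so the last scale dominates and the total is a multiple of `C n^(-β)`. Taking `r
= 4^⌈p⌉` makes the multiple at most `10 / (1/(2p) - β)`, with no other dependence on `p`. The bound
on exponents follows by letting `β` vary. -/

/-- The `L^p` norm `(∫ f^p dμ)^(1/p)` of a function with values in `[0, ∞]`. -/
noncomputable def lintegralNorm {α : Type*} [MeasurableSpace α] (p : ℝ) (f : α → ℝ≥0∞)
    (μ : Measure α) : ℝ≥0∞ :=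
  (∫⁻ x, f x ^ p ∂μ) ^ (1 / p)

/-! ### `L^p` norms of nonnegative functions -/

section LintegralNorm

variable {α β : Type*} [MeasurableSpace α] [MeasurableSpace β] {p : ℝ} {f g : α → ℝ≥0∞}
  {μ : Measure α}

theorem lintegralNorm_mono (hp : 1 ≤ p) (h : ∀ x, f x ≤ g x) :
    lintegralNorm p f μ ≤ lintegralNorm p g μ := by
  have hp0 : 0 ≤ p := by linarith
  exact ENNReal.rpow_le_rpow (lintegral_mono fun x => ENNReal.rpow_le_rpow (h x) hp0)
    (by positivity)

theorem lintegralNorm_add_le (hp : 1 ≤ p) (hf : Measurable f) (hg : Measurable g) :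
    lintegralNorm p (fun x => f x + g x) μ ≤ lintegralNorm p f μ + lintegralNorm p g μ :=
  ENNReal.lintegral_Lp_add_le hf.aemeasurable hg.aemeasurable hp

theorem lintegralNorm_const (hp : 1 ≤ p) [IsProbabilityMeasure μ] (c : ℝ≥0∞) :
    lintegralNorm p (fun _ => c) μ = c := by
  rw [lintegralNorm, lintegral_const, measure_univ, mul_one, ← ENNReal.rpow_mul,
    mul_one_div_cancel (by linarith), ENNReal.rpow_one]

theorem lintegralNorm_sum_le (hp : 1 ≤ p) {ι : Type*} (s : Finset ι) {F : ι → α → ℝ≥0∞}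
    (hF : ∀ i, Measurable (F i)) :
    lintegralNorm p (fun x => ∑ i ∈ s, F i x) μ ≤ ∑ i ∈ s, lintegralNorm p (F i) μ := by
  classical
  induction s using Finset.induction_on with
  | empty =>
    have h1 : (0 : ℝ) < p := by linarith
    simp [lintegralNorm, ENNReal.zero_rpow_of_pos h1, h1]
  | insert a s ha ih =>
    simp only [Finset.sum_insert ha]
    exact (lintegralNorm_add_le hp (hF a) (Finset.measurable_fun_sum _ fun i _ => hF i)).trans
      (add_le_add le_rfl ih)

theorem lintegralNorm_map {φ : α → β} (hφ : AEMeasurable φ μ) {f : β → ℝ≥0∞} (hf : Measurable f) :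
    lintegralNorm p f (μ.map φ) = lintegralNorm p (fun x => f (φ x)) μ := by
  rw [lintegralNorm, lintegral_map' (hf.pow_const p).aemeasurable hφ]
  rfl

end LintegralNorm

/-! ### Finitely supported measures -/

/-- The measure `∑ᵢ wᵢ δ_{yᵢ}`. -/
noncomputable def discreteMeasure {E ι : Type*} [MeasurableSpace E] [Fintype ι] (w : ι → ℝ≥0∞)
    (y : ι → E) : Measure E :=
  ∑ i, w i • Measure.dirac (y i)

theorem uniformMeasure_eq_discreteMeasure {E : Type*} [MeasurableSpace E] {n : ℕ} (x : Fin n → E) :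
    uniformMeasure x = discreteMeasure (fun _ => (n : ℝ≥0∞)⁻¹) x := by
  rw [uniformMeasure, discreteMeasure, Finset.smul_sum]

theorem discreteMeasure_univ {E ι : Type*} [MeasurableSpace E] [Fintype ι] (w : ι → ℝ≥0∞)
    (y : ι → E) : discreteMeasure w y Set.univ = ∑ i, w i := by
  simp [discreteMeasure]

theorem isProbabilityMeasure_uniformMeasure {E : Type*} [MeasurableSpace E] {n : ℕ} (hn : 0 < n)
    (x : Fin n → E) : IsProbabilityMeasure (uniformMeasure x) := by
  constructor
  rw [uniformMeasure_eq_discreteMeasure, discreteMeasure_univ]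
  simp [ENNReal.mul_inv_cancel (Nat.cast_ne_zero.2 hn.ne') (ENNReal.natCast_ne_top n)]

/-! ### Couplings with discrete measures and the triangle inequality -/

section Transport

variable {E : Type*} [MetricSpace E] [MeasurableSpace E] {p : ℝ}

theorem wassersteinDist_le {μ ν : Measure E} {γ : Measure (E × E)} (h : IsCoupling μ ν γ) :
    wassersteinDist p μ ν ≤ lintegralNorm p (fun z => edist z.1 z.2) γ :=
  iInf₂_le γ h

omit [MetricSpace E] in
theorem IsCoupling.swap {μ ν : Measure E} {γ : Measure (E × E)} (h : IsCoupling μ ν γ) :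
    IsCoupling ν μ (γ.map Prod.swap) := by
  have := h.isProbabilityMeasure
  refine ⟨Measure.isProbabilityMeasure_map measurable_swap.aemeasurable, ?_, ?_⟩
  · rw [Measure.map_map measurable_fst measurable_swap]
    exact h.map_snd
  · rw [Measure.map_map measurable_snd measurable_swap]
    exact h.map_fst

variable [SecondCountableTopology E] [BorelSpace E]

theorem lintegralNorm_edist_map_swap (γ : Measure (E × E)) :
    lintegralNorm p (fun z : E × E => edist z.1 z.2) (γ.map Prod.swap)
      = lintegralNorm p (fun z => edist z.1 z.2) γ := by
  rw [lintegralNorm_map measurable_swap.aemeasurable measurable_edist]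
  simp [edist_comm]

theorem wassersteinDist_comm (μ ν : Measure E) :
    wassersteinDist p μ ν = wassersteinDist p ν μ := by
  have key : ∀ μ ν : Measure E, wassersteinDist p μ ν ≤ wassersteinDist p ν μ := fun μ ν =>
    le_iInf₂ fun γ hγ => (wassersteinDist_le hγ.swap).trans_eq (lintegralNorm_edist_map_swap γ)
  exact le_antisymm (key _ _) (key _ _)

variable {ι : Type*} [Fintype ι]

/-- A coupling with a discrete measure decomposes the other marginal. -/
theorem IsCoupling.exists_decomposition {α : Measure E} {w : ι → ℝ≥0∞} {y : ι → E}
    {π : Measure (E × E)} (hπ : IsCoupling α (discreteMeasure w y) π) :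
    ∃ A : ι → Measure E, (∀ i, A i Set.univ = w i) ∧ ∑ i, A i = α ∧
      ∀ F : E × E → ℝ≥0∞, Measurable F → ∑ i, ∫⁻ x, F (x, y i) ∂A i = ∫⁻ z, F z ∂π := by
  classical
  have := hπ.isProbabilityMeasure
  set ν := discreteMeasure w y with hν
  have hνprob : IsProbabilityMeasure ν := by
    rw [← hπ.map_snd]; exact Measure.isProbabilityMeasure_map measurable_snd.aemeasurable
  have hνs : ∀ v : E, ν {v} = ∑ i, if y i = v then w i else 0 := by
    intro v
    simp only [hν, discreteMeasure, Measure.finsetSum_apply, Measure.smul_apply, smul_eq_mul]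
    refine Finset.sum_congr rfl fun i _ => ?_
    rw [Measure.dirac_apply' _ (measurableSet_singleton v)]
    by_cases h : y i = v <;> simp [h]
  have hms : ∀ v : E, MeasurableSet (Prod.snd ⁻¹' {v} : Set (E × E)) := fun v =>
    measurable_snd (measurableSet_singleton v)
  -- The points `y i` may coincide, so the part of `π` above an atom is shared among its indices in
  -- proportion to their weights.
  let h : ι → E × E → ℝ≥0∞ := fun i =>
    (Prod.snd ⁻¹' {y i} : Set (E × E)).indicator (fun _ => w i / ν {y i})
  have hmeas : ∀ i, Measurable (h i) := fun i => measurable_const.indicator (hms _)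
  have hwν : ∀ i, ν {y i} = 0 → w i = 0 := by
    intro i hi
    rw [hνs] at hi
    simpa using (Finset.sum_eq_zero_iff.1 hi) i (Finset.mem_univ i)
  have hsum : ∀ᵐ z ∂π, ∑ i, h i z = 1 := by
    have h1 : ∀ᵐ v ∂ν, ν {v} ≠ 0 := by
      rw [ae_iff]
      simp only [not_not]
      have hm : MeasurableSet {v | ν {v} = 0} := by
        have : {v | ν {v} = 0} = (Set.range y)ᶜ ∪ (Set.range y ∩ {v | ν {v} = 0}) := by
          ext v
          simp only [Set.mem_ofPred_eq, Set.mem_union, Set.mem_compl_iff, Set.mem_inter_iff]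
          constructor
          · intro hv; by_cases hr : v ∈ Set.range y <;> simp [hr, hv]
          · rintro (hv | hv)
            · rw [hνs]
              refine Finset.sum_eq_zero fun i _ => if_neg fun hi => hv ⟨i, hi⟩
            · exact hv.2
        rw [this]
        exact (Set.finite_range y).measurableSet.compl.union
          ((Set.finite_range y).inter_of_left _).measurableSet
      have hexp : ∀ s : Set E, ν s = ∑ i, w i * Measure.dirac (y i) s := fun s => by
        simp only [hν, discreteMeasure, Measure.finsetSum_apply, Measure.smul_apply, smul_eq_mul]
      rw [hexp]
      refine Finset.sum_eq_zero fun i _ => ?_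
      rw [Measure.dirac_apply' _ hm]
      by_cases hi : ν {y i} = 0
      · simp [hwν i hi]
      · rw [Set.indicator_of_notMem, mul_zero]
        exact hi
    rw [← hπ.map_snd] at h1
    filter_upwards [ae_of_ae_map measurable_snd.aemeasurable h1] with z hz
    rw [hπ.map_snd] at hz
    have : ∀ i, h i z = (if y i = z.2 then w i else 0) / ν {z.2} := by
      intro i
      simp only [h, Set.indicator_apply, Set.mem_preimage, Set.mem_singleton_iff]
      by_cases hi : y i = z.2
      · simp [hi]
      · simp [hi, Ne.symm hi]
    simp only [this, div_eq_mul_inv]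
    rw [← Finset.sum_mul, ← hνs, ENNReal.mul_inv_cancel hz (measure_ne_top _ _)]
  have hF : ∀ F : E × E → ℝ≥0∞, Measurable F →
      ∑ i, ∫⁻ x, F (x, y i) ∂((π.withDensity (h i)).map Prod.fst) = ∫⁻ z, F z ∂π := by
    intro F hFm
    have h1 : ∀ i, ∫⁻ x, F (x, y i) ∂((π.withDensity (h i)).map Prod.fst)
        = ∫⁻ z, h i z * F z ∂π := by
      intro i
      have hFi : Measurable fun x => F (x, y i) := by fun_prop
      rw [lintegral_map hFi measurable_fst,
        lintegral_withDensity_eq_lintegral_mul (g := fun z => F (z.1, y i)) _ (hmeas i)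
          (hFi.comp measurable_fst)]
      refine lintegral_congr fun z => ?_
      simp only [Pi.mul_apply, h, Set.indicator_apply, Set.mem_preimage, Set.mem_singleton_iff]
      by_cases hz : z.2 = y i
      · rw [← hz]
      · simp [hz]
    simp only [h1]
    rw [← lintegral_finsetSum (f := fun i z => h i z * F z) _ fun i _ => (hmeas i).mul hFm]
    refine lintegral_congr_ae ?_
    filter_upwards [hsum] with z hz
    rw [← Finset.sum_mul, hz, one_mul]
  refine ⟨fun i => (π.withDensity (h i)).map Prod.fst, fun i => ?_, ?_, hF⟩
  · rw [Measure.map_apply measurable_fst MeasurableSet.univ, Set.preimage_univ,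
      withDensity_apply _ MeasurableSet.univ, Measure.restrict_univ,
      lintegral_indicator_const (hms _), ← Measure.map_apply measurable_snd
        (measurableSet_singleton _), hπ.map_snd]
    by_cases hi : ν {y i} = 0
    · rw [hi, hwν i hi]; simp
    · exact ENNReal.div_mul_cancel hi (measure_ne_top _ _)
  · ext s hs
    have := hF (fun z => s.indicator 1 z.1) ((measurable_one.indicator hs).comp measurable_fst)
    simp only [lintegral_indicator_one hs] at this
    rw [Measure.finsetSum_apply, this, ← hπ.map_fst, Measure.map_apply measurable_fst hs,
      ← lintegral_indicator_one (measurable_fst hs)]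
    rfl

/-- The triangle inequality through a discrete measure. -/
theorem wassersteinDist_triangle_discrete (hp : 1 ≤ p) (α β : Measure E) (w : ι → ℝ≥0∞)
    (y : ι → E) : wassersteinDist p α β
      ≤ wassersteinDist p α (discreteMeasure w y) + wassersteinDist p (discreteMeasure w y) β := by
  rw [wassersteinDist_comm (discreteMeasure w y) β]
  simp only [wassersteinDist, ENNReal.iInf_add, ENNReal.add_iInf]
  refine le_iInf₂ fun π₂ h₂ => le_iInf₂ fun π₁ h₁ => ?_
  change wassersteinDist p α β ≤ lintegralNorm p (fun z => edist z.1 z.2) π₁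
    + lintegralNorm p (fun z => edist z.1 z.2) π₂
  obtain ⟨A, hA1, hA2, hA3⟩ := h₁.exists_decomposition
  obtain ⟨B, hB1, hB2, hB3⟩ := h₂.exists_decomposition
  have := h₁.isProbabilityMeasure
  have hα : IsProbabilityMeasure α := by
    rw [← h₁.map_fst]; exact Measure.isProbabilityMeasure_map measurable_fst.aemeasurable
  have hw : ∑ i, w i = 1 := by
    rw [← measure_univ (μ := α), ← hA2, Measure.finsetSum_apply]
    exact Finset.sum_congr rfl fun i _ => (hA1 i).symm
  have hwtop : ∀ i, w i ≠ ∞ := fun i =>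
    ((Finset.single_le_sum (fun _ _ => zero_le) (Finset.mem_univ i)).trans_lt
      (hw ▸ ENNReal.one_lt_top)).ne
  have hAf : ∀ i, IsFiniteMeasure (A i) := fun i => ⟨by rw [hA1]; exact (hwtop i).lt_top⟩
  have hBf : ∀ i, IsFiniteMeasure (B i) := fun i => ⟨by rw [hB1]; exact (hwtop i).lt_top⟩
  have hcancel : ∀ i (C : Measure E), C Set.univ = w i → (w i)⁻¹ • w i • C = C := by
    intro i C hC
    by_cases h0 : w i = 0
    · rw [h0, Measure.measure_univ_eq_zero] at hC
      simp [hC]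
    · rw [smul_smul, ENNReal.inv_mul_cancel h0 (hwtop i), one_smul]
  -- Gluing by conditional independence given the index `i`. A discrete middle marginal makes this a
  -- finite sum, so no disintegration is needed and `E` need not be complete. If `w i = 0`, then `A
  -- i` and `B i` vanish and the infinite factor is harmless.
  let Γ : Measure (E × E) := ∑ i, (w i)⁻¹ • (A i).prod (B i)
  have hΓ1 : Γ.map Prod.fst = α := by
    simp only [Γ]
    rw [Measure.map_finset_sum measurable_fst.aemeasurable, ← hA2]
    refine Finset.sum_congr rfl fun i _ => ?_
    rw [Measure.map_smul, Measure.map_fst_prod, hB1, hcancel i _ (hA1 i)]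
  have hΓ2 : Γ.map Prod.snd = β := by
    simp only [Γ]
    rw [Measure.map_finset_sum measurable_snd.aemeasurable, ← hB2]
    refine Finset.sum_congr rfl fun i _ => ?_
    rw [Measure.map_smul, Measure.map_snd_prod, hA1, hcancel i _ (hB1 i)]
  have hΓ : IsCoupling α β Γ := by
    refine ⟨⟨?_⟩, hΓ1, hΓ2⟩
    rw [← measure_univ (μ := α), ← hΓ1, Measure.map_apply measurable_fst MeasurableSet.univ,
      Set.preimage_univ]
  refine (wassersteinDist_le hΓ).trans ?_
  -- The same gluing with the middle point kept, so that the claim becomes Minkowski's inequality in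
  -- `L^p(T)`.
  let T : Measure (E × E × E) :=
    ∑ i, (w i)⁻¹ • ((A i).prod (B i)).map (fun z => (z.1, y i, z.2))
  have hm : ∀ i, Measurable (fun z : E × E => (z.1, y i, z.2)) := fun i => by fun_prop
  have hT : ∀ f : E × E × E → ℝ≥0∞, Measurable f →
      ∫⁻ t, f t ∂T = ∑ i, (w i)⁻¹ * ∫⁻ z, f (z.1, y i, z.2) ∂((A i).prod (B i)) := by
    intro f hf
    simp only [T, lintegral_finsetSum_measure, lintegral_smul_measure, smul_eq_mul]
    refine Finset.sum_congr rfl fun i _ => ?_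
    rw [lintegral_map hf (hm i)]
  have hmul : ∀ i c, (c ≠ 0 → w i ≠ 0) → (w i)⁻¹ * (c * w i) = c := by
    intro i c hc
    by_cases h0 : w i = 0
    · have : c = 0 := by by_contra h; exact hc h h0
      simp [this]
    · rw [mul_comm c, ← mul_assoc, ENNReal.inv_mul_cancel h0 (hwtop i), one_mul]
  have hzero : ∀ i (C : Measure E) (f : E → ℝ≥0∞), C Set.univ = w i → ∫⁻ x, f x ∂C ≠ 0 →
      w i ≠ 0 := by
    intro i C f hC hne h0
    rw [h0, Measure.measure_univ_eq_zero] at hC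
    simp [hC] at hne
  have e13 : Measurable (fun t : E × E × E => edist t.1 t.2.2) :=
    measurable_edist.comp (measurable_fst.prodMk measurable_snd.snd)
  have e12 : Measurable (fun t : E × E × E => edist t.1 t.2.1) :=
    measurable_edist.comp (measurable_fst.prodMk measurable_snd.fst)
  have e23 : Measurable (fun t : E × E × E => edist t.2.1 t.2.2) :=
    measurable_edist.comp (measurable_snd.fst.prodMk measurable_snd.snd)
  have c13 : lintegralNorm p (fun z : E × E => edist z.1 z.2) Γ
      = lintegralNorm p (fun t : E × E × E => edist t.1 t.2.2) T := by
    unfold lintegralNorm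
    rw [hT _ (e13.pow_const p)]
    simp only [Γ, lintegral_finsetSum_measure, lintegral_smul_measure, smul_eq_mul]
  have c12 : lintegralNorm p (fun t : E × E × E => edist t.1 t.2.1) T
      = lintegralNorm p (fun z : E × E => edist z.1 z.2) π₁ := by
    unfold lintegralNorm
    rw [hT _ (e12.pow_const p), ← hA3 _ (measurable_edist.pow_const p)]
    congr 1
    refine Finset.sum_congr rfl fun i _ => ?_
    have : ∫⁻ z, edist z.1 (y i) ^ p ∂((A i).prod (B i)) = (∫⁻ x, edist x (y i) ^ p ∂A i) * w i := by
      rw [lintegral_prod _ (by fun_prop)]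
      simp only [lintegral_const, hB1]
      rw [lintegral_mul_const]
      fun_prop
    rw [this]
    exact hmul i _ (hzero i _ _ (hA1 i))
  have c23 : lintegralNorm p (fun t : E × E × E => edist t.2.1 t.2.2) T
      = lintegralNorm p (fun z : E × E => edist z.1 z.2) π₂ := by
    unfold lintegralNorm
    rw [hT _ (e23.pow_const p), ← hB3 _ (measurable_edist.pow_const p)]
    congr 1
    refine Finset.sum_congr rfl fun i _ => ?_
    have : ∫⁻ z, edist (y i) z.2 ^ p ∂((A i).prod (B i)) = (∫⁻ x, edist x (y i) ^ p ∂B i) * w i := by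
      rw [lintegral_prod _ (by fun_prop)]
      simp [lintegral_const, hA1, edist_comm]
    rw [this]
    exact hmul i _ (hzero i _ _ (hB1 i))
  rw [c13, ← c12, ← c23]
  exact (lintegralNorm_mono hp fun t => edist_triangle _ _ _).trans
    (lintegralNorm_add_le hp e12 e23)

variable {κ : Type*} [Fintype κ]

/-- The coupling of two discrete measures given by a matrix. -/
theorem wassersteinDist_discreteMeasure_le {w : ι → ℝ≥0∞} {v : κ → ℝ≥0∞} (x : ι → E) (y : κ → E)
    (M : ι → κ → ℝ≥0∞) (hrow : ∀ i, ∑ j, M i j = w i) (hcol : ∀ j, ∑ i, M i j = v j)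
    (hw : ∑ i, w i = 1) :
    wassersteinDist p (discreteMeasure w x) (discreteMeasure v y)
      ≤ (∑ i, ∑ j, M i j * edist (x i) (y j) ^ p) ^ (1 / p) := by
  let Γ : Measure (E × E) := ∑ i, ∑ j, M i j • Measure.dirac (x i, y j)
  have h1 : Γ.map Prod.fst = discreteMeasure w x := by
    simp only [Γ, discreteMeasure]
    rw [Measure.map_finset_sum measurable_fst.aemeasurable]
    refine Finset.sum_congr rfl fun i _ => ?_
    rw [Measure.map_finset_sum measurable_fst.aemeasurable, ← hrow, Finset.sum_smul]
    refine Finset.sum_congr rfl fun j _ => ?_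
    rw [Measure.map_smul, Measure.map_dirac' measurable_fst]
  have h2 : Γ.map Prod.snd = discreteMeasure v y := by
    simp only [Γ, discreteMeasure]
    rw [Finset.sum_comm, Measure.map_finset_sum measurable_snd.aemeasurable]
    refine Finset.sum_congr rfl fun i _ => ?_
    rw [Measure.map_finset_sum measurable_snd.aemeasurable, ← hcol, Finset.sum_smul]
    refine Finset.sum_congr rfl fun j _ => ?_
    rw [Measure.map_smul, Measure.map_dirac' measurable_snd]
  have hΓ : IsCoupling (discreteMeasure w x) (discreteMeasure v y) Γ := by
    refine ⟨⟨?_⟩, h1, h2⟩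
    rw [← hw, ← discreteMeasure_univ w x, ← h1, Measure.map_apply measurable_fst MeasurableSet.univ,
      Set.preimage_univ]
  refine (wassersteinDist_le hΓ).trans_eq ?_
  simp only [lintegralNorm, Γ, lintegral_finsetSum_measure, lintegral_smul_measure, smul_eq_mul,
    lintegral_dirac]

theorem wassersteinDist_uniformMeasure_le {n : ℕ} (hn : 0 < n) (x y : Fin n → E) :
    wassersteinDist p (uniformMeasure x) (uniformMeasure y)
      ≤ ((n : ℝ≥0∞)⁻¹ * ∑ i, edist (x i) (y i) ^ p) ^ (1 / p) := by
  rw [uniformMeasure_eq_discreteMeasure, uniformMeasure_eq_discreteMeasure]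
  refine (wassersteinDist_discreteMeasure_le x y
    (fun i j => if i = j then (n : ℝ≥0∞)⁻¹ else 0) (by simp) (by simp) ?_).trans_eq ?_
  · simp [ENNReal.mul_inv_cancel (Nat.cast_ne_zero.2 hn.ne') (ENNReal.natCast_ne_top n)]
  · simp [ite_mul, Finset.mul_sum]

theorem wassersteinDist_uniformMeasure_le_edist (hp : 1 ≤ p) {n : ℕ} (hn : 0 < n)
    (x y : Fin n → E) :
    wassersteinDist p (uniformMeasure x) (uniformMeasure y) ≤ edist x y := by
  refine (wassersteinDist_uniformMeasure_le hn x y).trans ?_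
  have hp0 : 0 < p := by linarith
  calc ((n : ℝ≥0∞)⁻¹ * ∑ i, edist (x i) (y i) ^ p) ^ (1 / p)
      ≤ ((n : ℝ≥0∞)⁻¹ * ∑ _i : Fin n, edist x y ^ p) ^ (1 / p) := by
        gcongr with i
        exact edist_le_pi_edist x y i
    _ = edist x y := by
        rw [Finset.sum_const, Finset.card_univ, Fintype.card_fin, nsmul_eq_mul, ← mul_assoc,
          ENNReal.inv_mul_cancel (Nat.cast_ne_zero.2 hn.ne') (ENNReal.natCast_ne_top n), one_mul,
          ← ENNReal.rpow_mul, mul_one_div_cancel hp0.ne', ENNReal.rpow_one]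

/-- The dependence is 1-Lipschitz for the sup distance on samples, by the triangle inequality
through the discrete measure on `y`. The purpose is measurability of the error as a function of the
sample. -/
theorem continuous_wassersteinDist_uniformMeasure (hp : 1 ≤ p) {n : ℕ} (hn : 0 < n)
    (ν : Measure E) : Continuous fun x : Fin n → E => wassersteinDist p (uniformMeasure x) ν := by
  refine continuous_of_le_add_edist 1 (by simp) fun x y => ?_
  rw [one_mul, add_comm]
  refine le_trans ?_ (add_le_add (wassersteinDist_uniformMeasure_le_edist hp hn x y) le_rfl)
  have := wassersteinDist_triangle_discrete hp (uniformMeasure x) ν (fun _ => (n : ℝ≥0∞)⁻¹) y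
  rwa [← uniformMeasure_eq_discreteMeasure] at this

theorem measurable_wassersteinDist_uniformMeasure (hp : 1 ≤ p) {n : ℕ} (hn : 0 < n)
    (ν : Measure E) :
    Measurable fun x : Fin n → E => wassersteinDist p (uniformMeasure x) ν :=
  (continuous_wassersteinDist_uniformMeasure hp hn ν).measurable

end Transport

/-! ### Moving mass inside classes, and matching two quantizers -/

section Transport

variable {E : Type*} [MetricSpace E] [MeasurableSpace E] [SecondCountableTopology E]
  [BorelSpace E] {p : ℝ}

/-- If two weights give the same mass to each fibre of `c`, then only the difference of the weights
has to be moved, and it can be moved through a centre `z j` of each fibre. -/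
theorem wassersteinDist_discreteMeasure_le_of_fiber {ι κ : Type*} [Fintype ι] [DecidableEq κ]
    (hp : 1 ≤ p) (y : ι → E) (c : ι → κ) (z : κ → E) (σ τ : ι → ℝ≥0∞) (hσ : ∑ i, σ i = 1)
    (h : ∀ j, ∑ i with c i = j, σ i = ∑ i with c i = j, τ i) :
    wassersteinDist p (discreteMeasure σ y) (discreteMeasure τ y)
      ≤ (2 ^ (p - 1) * ∑ i, ((σ i - τ i) + (τ i - σ i)) * edist (y i) (z (c i)) ^ p) ^ (1 / p) := by
  classical
  have hp0 : 0 < p := by linarith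
  set a : ι → ℝ≥0∞ := fun i => σ i - τ i with ha
  set b : ι → ℝ≥0∞ := fun i => τ i - σ i with hb
  have hminσ : ∀ i, min (σ i) (τ i) + a i = σ i := fun i => by
    rcases le_total (σ i) (τ i) with h | h
    · simp [ha, h, tsub_eq_zero_of_le h]
    · simp [ha, h, add_tsub_cancel_of_le h]
  have hminτ : ∀ i, min (σ i) (τ i) + b i = τ i := fun i => by
    rcases le_total (σ i) (τ i) with h | h
    · simp [hb, h, add_tsub_cancel_of_le h]
    · simp [hb, h, tsub_eq_zero_of_le h]
  have hfin : ∀ (s : Finset ι), ∑ i ∈ s, σ i ≠ ∞ := fun s =>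
    ((Finset.sum_le_sum_of_subset (Finset.subset_univ s)).trans_lt (hσ ▸ ENNReal.one_lt_top)).ne
  set R : κ → ℝ≥0∞ := fun j => ∑ i with c i = j, a i with hR
  have hRb : ∀ j, ∑ i with c i = j, b i = R j := by
    intro j
    have h1 : ∑ i with c i = j, min (σ i) (τ i) + ∑ i with c i = j, a i
        = ∑ i with c i = j, min (σ i) (τ i) + ∑ i with c i = j, b i := by
      rw [← Finset.sum_add_distrib, ← Finset.sum_add_distrib,
        Finset.sum_congr rfl fun i _ => hminσ i, Finset.sum_congr rfl fun i _ => hminτ i, h j]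
    refine ((ENNReal.add_right_inj ?_).1 h1).symm
    exact ((Finset.sum_le_sum fun i _ => min_le_left _ _).trans_lt (hfin _).lt_top).ne
  have hRfin : ∀ j, R j ≠ ∞ := fun j =>
    ((Finset.sum_le_sum fun i _ => tsub_le_self).trans_lt (hfin _).lt_top).ne
  have hcancel : ∀ (f : ι → ℝ≥0∞), (∀ i, f i ≤ R (c i)) → ∀ i, f i / R (c i) * R (c i) = f i := by
    intro f hf i
    by_cases h0 : R (c i) = 0
    · have : f i = 0 := le_antisymm (h0 ▸ hf i) zero_le
      simp [this]
    · exact ENNReal.div_mul_cancel h0 (hRfin _)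
  have haR : ∀ i, a i ≤ R (c i) := fun i =>
    Finset.single_le_sum (f := a) (fun _ _ => zero_le) (by simp)
  have hbR : ∀ i, b i ≤ R (c i) := fun i =>
    (Finset.single_le_sum (f := b) (fun _ _ => zero_le) (by simp)).trans_eq (hRb _)
  -- The common mass `min σ τ` stays in place. In each fibre the excess `a` and the deficit `b` have
  -- the same total `R`, and are joined by the normalized product coupling.
  let Q : ι → ι → ℝ≥0∞ := fun i j => if c i = c j then a i * b j / R (c i) else 0
  have hQrow : ∀ i, ∑ j, Q i j = a i := by
    intro i
    calc ∑ j, Q i j = ∑ j, if c j = c i then a i / R (c i) * b j else 0 := by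
          refine Finset.sum_congr rfl fun j _ => ?_
          simp only [Q, eq_comm (a := c i)]
          split_ifs
          · rw [div_eq_mul_inv, div_eq_mul_inv]; ring
          · rfl
      _ = a i := by rw [← Finset.sum_filter, ← Finset.mul_sum, hRb, hcancel a haR]
  have hQcol : ∀ j, ∑ i, Q i j = b j := by
    intro j
    calc ∑ i, Q i j = ∑ i, if c i = c j then b j / R (c j) * a i else 0 := by
          refine Finset.sum_congr rfl fun i _ => ?_
          simp only [Q]
          split_ifs with hc
          · rw [hc, div_eq_mul_inv, div_eq_mul_inv]; ring
          · rfl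
      _ = b j := by rw [← Finset.sum_filter, ← Finset.mul_sum]; exact hcancel b hbR j
  refine (wassersteinDist_discreteMeasure_le y y
    (fun i j => (if i = j then min (σ i) (τ i) else 0) + Q i j) (fun i => ?_) (fun j => ?_)
    hσ).trans ?_
  · rw [Finset.sum_add_distrib, hQrow]
    simp [hminσ]
  · rw [Finset.sum_add_distrib, hQcol]
    simp [hminτ]
  refine ENNReal.rpow_le_rpow ?_ (by positivity)
  set D : ι → ℝ≥0∞ := fun i => edist (y i) (z (c i)) ^ p with hD
  -- Both endpoints lie in one fibre and are compared with its centre; `2 ^ (p - 1)` is the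
  -- convexity constant of `t ↦ t ^ p`.
  have hQD : ∀ i j, Q i j * edist (y i) (y j) ^ p ≤ 2 ^ (p - 1) * (Q i j * D i + Q i j * D j) := by
    intro i j
    by_cases hc : c i = c j
    · calc Q i j * edist (y i) (y j) ^ p
          ≤ Q i j * (2 ^ (p - 1) * (D i + D j)) := by
            refine mul_le_mul_right ?_ _
            refine (ENNReal.rpow_le_rpow (edist_triangle_right (y i) (y j) (z (c i))) hp0.le).trans
              ((ENNReal.rpow_add_le_mul_rpow_add_rpow _ _ hp).trans_eq ?_)
            simp only [hD, hc]
        _ = _ := by ring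
    · simp [Q, hc]
  calc ∑ i, ∑ j, ((if i = j then min (σ i) (τ i) else 0) + Q i j) * edist (y i) (y j) ^ p
      = ∑ i, ∑ j, Q i j * edist (y i) (y j) ^ p := by
        refine Finset.sum_congr rfl fun i _ => Finset.sum_congr rfl fun j _ => ?_
        by_cases hij : i = j
        · simp [hij, hp0]
        · simp [hij]
    _ ≤ ∑ i, ∑ j, 2 ^ (p - 1) * (Q i j * D i + Q i j * D j) :=
        Finset.sum_le_sum fun i _ => Finset.sum_le_sum fun j _ => hQD i j
    _ = 2 ^ (p - 1) * ∑ i, (a i + b i) * D i := by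
        simp only [← Finset.mul_sum, Finset.sum_add_distrib]
        congr 1
        rw [Finset.sum_comm (f := fun i j => Q i j * D j)]
        simp only [← Finset.sum_mul, hQrow, hQcol, add_mul, Finset.sum_add_distrib]

/-- A form of Birkhoff's theorem: a doubly stochastic cost is at least a permutation cost. -/
theorem le_sum_mul_of_doublyStochastic {ι : Type*} [Fintype ι] (P D : ι → ι → ℝ≥0∞) (c : ℝ≥0∞)
    (hrow : ∀ i, ∑ j, P i j = 1) (hcol : ∀ j, ∑ i, P i j = 1)
    (hc : ∀ σ : Equiv.Perm ι, c ≤ ∑ i, D i (σ i)) : c ≤ ∑ i, ∑ j, P i j * D i j := by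
  classical
  have hP : ∀ i j, P i j ≠ ∞ := fun i j =>
    ((Finset.single_le_sum (fun _ _ => zero_le) (Finset.mem_univ j)).trans_lt
      (hrow i ▸ ENNReal.one_lt_top)).ne
  -- Only `P` is passed to the reals; the costs `D` may be infinite.
  have hM : Matrix.of (fun i j => (P i j).toReal) ∈ doublyStochastic ℝ ι := by
    rw [mem_doublyStochastic_iff_sum]
    refine ⟨fun i j => ENNReal.toReal_nonneg, fun i => ?_, fun j => ?_⟩
    · simp only [Matrix.of_apply]
      rw [← ENNReal.toReal_sum fun j _ => hP i j, hrow, ENNReal.toReal_one]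
    · simp only [Matrix.of_apply]
      rw [← ENNReal.toReal_sum fun i _ => hP i j, hcol, ENNReal.toReal_one]
  obtain ⟨w, hw0, hw1, hw⟩ := exists_eq_sum_perm_of_mem_doublyStochastic hM
  have hPw : ∀ i j, P i j = ∑ σ : Equiv.Perm ι, ENNReal.ofReal (w σ) * if σ i = j then 1 else 0 := by
    intro i j
    have h1 := congr_fun (congr_fun hw i) j
    simp only [Matrix.sum_apply, Matrix.smul_apply, Equiv.Perm.permMatrix,
      Equiv.toPEquiv_apply, PEquiv.toMatrix_apply, smul_eq_mul, Matrix.of_apply] at h1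
    rw [← ENNReal.ofReal_toReal (hP i j), ← h1, ENNReal.ofReal_sum_of_nonneg]
    · refine Finset.sum_congr rfl fun σ _ => ?_
      by_cases hσ : σ i = j <;> simp [hσ]
    · intro σ _
      have := hw0 σ
      positivity
  calc c = ∑ σ : Equiv.Perm ι, ENNReal.ofReal (w σ) * c := by
        rw [← Finset.sum_mul, ← ENNReal.ofReal_sum_of_nonneg fun σ _ => hw0 σ, hw1,
          ENNReal.ofReal_one, one_mul]
    _ ≤ ∑ σ : Equiv.Perm ι, ENNReal.ofReal (w σ) * ∑ i, D i (σ i) :=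
        Finset.sum_le_sum fun σ _ => mul_le_mul_right (hc σ) _
    _ = ∑ i, ∑ j, P i j * D i j := by
        simp only [hPw, Finset.sum_mul, Finset.mul_sum]
        rw [Finset.sum_comm]
        refine Finset.sum_congr rfl fun i _ => ?_
        rw [Finset.sum_comm]
        refine Finset.sum_congr rfl fun σ _ => ?_
        simp

-- Each part satisfies `A i ≤ μ`, so Radon-Nikodym applies. The densities serve as the conditional
-- law of the index given the point, which replaces disintegration when two couplings are glued
-- along `μ`.
omit [BorelSpace E] [SecondCountableTopology E] [MetricSpace E] in
theorem exists_density {ι : Type*} [Fintype ι] {μ : Measure E} [IsProbabilityMeasure μ]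
    (A : ι → Measure E) (hA : ∑ i, A i = μ) :
    ∃ f : ι → E → ℝ≥0∞, (∀ i, Measurable (f i)) ∧ (∀ i, A i = μ.withDensity (f i)) ∧
      ∀ᵐ x ∂μ, ∑ i, f i x = 1 := by
  have hle : ∀ i, A i ≤ μ := fun i s => by
    rw [← hA, Measure.finsetSum_apply]
    exact Finset.single_le_sum (f := fun i => A i s) (fun _ _ => zero_le) (Finset.mem_univ i)
  have hfin : ∀ i, IsFiniteMeasure (A i) := fun i => isFiniteMeasure_of_le μ (hle i)
  have hd : ∀ i, A i = μ.withDensity ((A i).rnDeriv μ) := fun i =>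
    (Measure.withDensity_rnDeriv_eq _ _ (Measure.absolutelyContinuous_of_le (hle i))).symm
  refine ⟨fun i => (A i).rnDeriv μ, fun i => Measure.measurable_rnDeriv _ _, hd, ?_⟩
  have hm : Measurable fun x => ∑ i, (A i).rnDeriv μ x :=
    Finset.measurable_fun_sum _ fun i _ => Measure.measurable_rnDeriv _ _
  have hw : μ.withDensity (fun x => ∑ i, (A i).rnDeriv μ x) = μ.withDensity 1 := by
    rw [withDensity_one]
    conv_rhs => rw [← hA]
    ext s hs
    rw [withDensity_apply _ hs, lintegral_finsetSum _ fun i _ => Measure.measurable_rnDeriv _ _,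
      Measure.finsetSum_apply]
    refine Finset.sum_congr rfl fun i _ => ?_
    conv_rhs => rw [hd i]
    rw [withDensity_apply _ hs]
  exact (withDensity_eq_iff_of_sigmaFinite hm.aemeasurable aemeasurable_const).1 hw

/-- Two discretizations of `μ` can be matched by a permutation. -/
theorem exists_perm_le_wassersteinDist_add {μ : Measure E} [IsProbabilityMeasure μ]
    (hp : 1 ≤ p) {m : ℕ} (hm : 0 < m) (x y : Fin m → E) :
    ∃ σ : Equiv.Perm (Fin m), ((m : ℝ≥0∞)⁻¹ * ∑ i, edist (x i) (y (σ i)) ^ p) ^ (1 / p)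
      ≤ wassersteinDist p μ (uniformMeasure x) + wassersteinDist p μ (uniformMeasure y) := by
  have hm0 : (m : ℝ≥0∞) ≠ 0 := Nat.cast_ne_zero.2 hm.ne'
  have hmt : (m : ℝ≥0∞) ≠ ∞ := ENNReal.natCast_ne_top m
  -- The permutation is fixed as a minimizer before the couplings are chosen, so that one
  -- permutation serves for both infima.
  obtain ⟨σ, hσ⟩ := Finite.exists_min fun σ : Equiv.Perm (Fin m) =>
    ∑ i, edist (x i) (y (σ i)) ^ p
  refine ⟨σ, ?_⟩
  rw [uniformMeasure_eq_discreteMeasure, uniformMeasure_eq_discreteMeasure]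
  rw [wassersteinDist, wassersteinDist]
  simp only [ENNReal.iInf_add, ENNReal.add_iInf]
  refine le_iInf₂ fun π₂ h₂ => le_iInf₂ fun π₁ h₁ => ?_
  change _ ≤ lintegralNorm p (fun z => edist z.1 z.2) π₁
    + lintegralNorm p (fun z => edist z.1 z.2) π₂
  obtain ⟨A, hA1, hA2, hA3⟩ := h₁.exists_decomposition
  obtain ⟨B, hB1, hB2, hB3⟩ := h₂.exists_decomposition
  obtain ⟨f, hfm, hfA, hf1⟩ := exists_density A hA2
  obtain ⟨g, hgm, hgB, hg1⟩ := exists_density B hB2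
  have hfg : ∀ i j, Measurable fun e => f i e * g j e := fun i j => (hfm i).mul (hgm j)
  -- Given the middle point `e`, the two indices are drawn independently with probabilities `f i e`
  -- and `g j e`.
  let T : Measure (E × E × E) :=
    ∑ i, ∑ j, (μ.withDensity (fun e => f i e * g j e)).map (fun e => (x i, e, y j))
  have hT : ∀ F : E × E × E → ℝ≥0∞, Measurable F →
      ∫⁻ t, F t ∂T = ∑ i, ∑ j, ∫⁻ e, f i e * g j e * F (x i, e, y j) ∂μ := by
    intro F hF
    simp only [T, lintegral_finsetSum_measure]
    refine Finset.sum_congr rfl fun i _ => Finset.sum_congr rfl fun j _ => ?_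
    rw [lintegral_map hF (by fun_prop), lintegral_withDensity_eq_lintegral_mul _ (hfg i j)
      (by fun_prop)]
    rfl
  have hTf : ∀ F : E → E → ℝ≥0∞, (∀ i, Measurable (F i)) →
      ∑ i, ∑ j, ∫⁻ e, f i e * g j e * F (x i) e ∂μ = ∑ i, ∫⁻ e, F (x i) e ∂A i := by
    intro F hF
    refine Finset.sum_congr rfl fun i _ => ?_
    rw [← lintegral_finsetSum (f := fun j e => f i e * g j e * F (x i) e) _
      fun j _ => (hfg i j).mul (hF _), hfA,
      lintegral_withDensity_eq_lintegral_mul _ (hfm i) (hF _)]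
    refine lintegral_congr_ae ?_
    filter_upwards [hg1] with e he
    rw [← Finset.sum_mul, ← Finset.mul_sum, he, mul_one, Pi.mul_apply]
  have hTg : ∀ F : E → E → ℝ≥0∞, (∀ i, Measurable (F i)) →
      ∑ i, ∑ j, ∫⁻ e, f i e * g j e * F (y j) e ∂μ = ∑ j, ∫⁻ e, F (y j) e ∂B j := by
    intro F hF
    rw [Finset.sum_comm]
    refine Finset.sum_congr rfl fun j _ => ?_
    rw [← lintegral_finsetSum (f := fun i e => f i e * g j e * F (y j) e) _
      fun i _ => (hfg i j).mul (hF _), hgB,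
      lintegral_withDensity_eq_lintegral_mul _ (hgm j) (hF _)]
    refine lintegral_congr_ae ?_
    filter_upwards [hf1] with e he
    rw [← Finset.sum_mul, ← Finset.sum_mul, he, one_mul, Pi.mul_apply]
  have e13 : Measurable (fun t : E × E × E => edist t.1 t.2.2) :=
    measurable_edist.comp (measurable_fst.prodMk measurable_snd.snd)
  have e12 : Measurable (fun t : E × E × E => edist t.1 t.2.1) :=
    measurable_edist.comp (measurable_fst.prodMk measurable_snd.fst)
  have e23 : Measurable (fun t : E × E × E => edist t.2.1 t.2.2) :=
    measurable_edist.comp (measurable_snd.fst.prodMk measurable_snd.snd)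
  have c12 : lintegralNorm p (fun t : E × E × E => edist t.1 t.2.1) T
      = lintegralNorm p (fun z : E × E => edist z.1 z.2) π₁ := by
    unfold lintegralNorm
    rw [hT _ (e12.pow_const p), ← hA3 _ (measurable_edist.pow_const p)]
    rw [hTf (fun a e => edist a e ^ p) fun i => by fun_prop]
    simp only [edist_comm]
  have c23 : lintegralNorm p (fun t : E × E × E => edist t.2.1 t.2.2) T
      = lintegralNorm p (fun z : E × E => edist z.1 z.2) π₂ := by
    unfold lintegralNorm
    rw [hT _ (e23.pow_const p), ← hB3 _ (measurable_edist.pow_const p)]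
    rw [hTg (fun a e => edist e a ^ p) fun i => by fun_prop]
  rw [← c12, ← c23]
  refine le_trans ?_ ((lintegralNorm_mono hp fun t => edist_triangle _ _ _).trans
    (lintegralNorm_add_le hp e12 e23))
  refine ENNReal.rpow_le_rpow ?_ (by positivity)
  rw [hT _ (e13.pow_const p)]
  set P : Fin m → Fin m → ℝ≥0∞ := fun i j => ∫⁻ e, f i e * g j e ∂μ with hP
  have hrow : ∀ i, ∑ j, P i j = (m : ℝ≥0∞)⁻¹ := by
    intro i
    rw [← hA1 i, hfA, withDensity_apply _ MeasurableSet.univ, Measure.restrict_univ,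
      ← lintegral_finsetSum _ fun j _ => hfg i j]
    refine lintegral_congr_ae ?_
    filter_upwards [hg1] with e he
    rw [← Finset.mul_sum, he, mul_one]
  have hcol : ∀ j, ∑ i, P i j = (m : ℝ≥0∞)⁻¹ := by
    intro j
    rw [← hB1 j, hgB, withDensity_apply _ MeasurableSet.univ, Measure.restrict_univ,
      ← lintegral_finsetSum _ fun i _ => hfg i j]
    refine lintegral_congr_ae ?_
    filter_upwards [hf1] with e he
    rw [← Finset.sum_mul, he, one_mul]
  -- The joint law of the two indices has uniform marginals, so `m * P` is doubly stochastic and the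
  -- glued cost is at least the best permutation cost.
  have key := le_sum_mul_of_doublyStochastic (fun i j => m * P i j)
    (fun i j => edist (x i) (y j) ^ p) _
    (fun i => by rw [← Finset.mul_sum, hrow, ENNReal.mul_inv_cancel hm0 hmt])
    (fun j => by rw [← Finset.mul_sum, hcol, ENNReal.mul_inv_cancel hm0 hmt]) hσ
  calc (m : ℝ≥0∞)⁻¹ * ∑ i, edist (x i) (y (σ i)) ^ p
      ≤ (m : ℝ≥0∞)⁻¹ * ∑ i, ∑ j, m * P i j * edist (x i) (y j) ^ p := mul_le_mul_right key _
    _ = ∑ i, ∑ j, ∫⁻ e, f i e * g j e * edist (x i) (y j) ^ p ∂μ := by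
        rw [Finset.mul_sum]
        refine Finset.sum_congr rfl fun i _ => ?_
        rw [Finset.mul_sum]
        refine Finset.sum_congr rfl fun j _ => ?_
        rw [lintegral_mul_const _ (hfg i j), ← mul_assoc, ← mul_assoc,
          ENNReal.inv_mul_cancel hm0 hmt, one_mul]

end Transport

/-! ### Expected error on the product space and its stability -/

section ExpectedError

variable {E : Type*} [MetricSpace E] [MeasurableSpace E] {p : ℝ}

/-- The error of the empirical measure, computed on the space of samples. -/
noncomputable def expectedError (p : ℝ) (μ : Measure E) (n : ℕ) : ℝ≥0∞ :=
  lintegralNorm p (fun x : Fin n → E => wassersteinDist p (uniformMeasure x) μ)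
    (Measure.pi fun _ => μ)

variable [SecondCountableTopology E] [BorelSpace E]

theorem empiricalError_eq_expectedError {Ω : Type*} [MeasurableSpace Ω] {P : Measure Ω}
    [IsProbabilityMeasure P] {X : ℕ → Ω → E} {μ : Measure E} (hp : 1 ≤ p)
    (hlaw : ∀ i, HasLaw (X i) μ P) (hindep : iIndepFun X P) {n : ℕ} (hn : 0 < n) :
    empiricalError P X p μ n = expectedError p μ n := by
  have hX : ∀ i : Fin n, AEMeasurable (X i) P := fun i => (hlaw i).aemeasurable
  have h1 : iIndepFun (fun i : Fin n => X i) P := hindep.precomp Fin.val_injective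
  have h2 := (iIndepFun_iff_map_fun_eq_pi_map hX).1 h1
  simp only [(hlaw _).map_eq] at h2
  rw [expectedError, ← h2, lintegralNorm_map (aemeasurable_pi_lambda _ hX)
    (measurable_wassersteinDist_uniformMeasure hp hn μ)]
  rfl

theorem lintegralNorm_eval_average {α : Type*} [MeasurableSpace α] (γ : Measure α)
    [IsProbabilityMeasure γ] {n : ℕ} (hn : 0 < n) (hp : 1 ≤ p) {f : α → ℝ≥0∞} (hf : Measurable f) :
    lintegralNorm p (fun z : Fin n → α => ((n : ℝ≥0∞)⁻¹ * ∑ i, f (z i) ^ p) ^ (1 / p))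
      (Measure.pi fun _ => γ) = lintegralNorm p f γ := by
  have hp0 : p ≠ 0 := by linarith
  unfold lintegralNorm
  congr 1
  have hfp := hf.pow_const p
  simp only [← ENNReal.rpow_mul, one_div_mul_cancel hp0, ENNReal.rpow_one]
  rw [lintegral_const_mul _ (by fun_prop), lintegral_finsetSum _ (by fun_prop)]
  have h : ∀ i : Fin n, ∫⁻ z, f (z i) ^ p ∂(Measure.pi fun _ : Fin n => γ) = ∫⁻ a, f a ^ p ∂γ :=
    fun i => (measurePreserving_eval (fun _ : Fin n => γ) i).lintegral_comp hfp
  simp only [h, Finset.sum_const, Finset.card_univ, Fintype.card_fin, nsmul_eq_mul]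
  rw [← mul_assoc, ENNReal.inv_mul_cancel (Nat.cast_ne_zero.2 hn.ne') (ENNReal.natCast_ne_top n),
    one_mul]

/-- The expected error of `μ` is controlled by that of a discretization. -/
theorem expectedError_le_add (hp : 1 ≤ p) {μ : Measure E} [IsProbabilityMeasure μ] {n m : ℕ}
    (hn : 0 < n) (hm : 0 < m) (y : Fin m → E) :
    expectedError p μ n ≤ expectedError p (uniformMeasure y) n
      + 2 * wassersteinDist p μ (uniformMeasure y) := by
  set ν := uniformMeasure y with hν
  have := isProbabilityMeasure_uniformMeasure hm y
  -- Pairs are sampled independently from `γ`: the first coordinates sample `μ`, the second `ν`.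
  -- Matching the samples index by index costs the norm of `γ` on average; going from `ν` back to
  -- `μ` costs the second copy of the distance.
  have key : ∀ γ, IsCoupling μ ν γ → expectedError p μ n ≤ expectedError p ν n
      + wassersteinDist p μ ν + lintegralNorm p (fun z => edist z.1 z.2) γ := by
    intro γ hγ
    have := hγ.isProbabilityMeasure
    have hfst : Measure.map (fun (z : Fin n → E × E) i => (z i).1) (Measure.pi fun _ => γ)
        = Measure.pi fun _ => μ := by
      have h0 : ∀ _i : Fin n, SigmaFinite (Measure.map Prod.fst γ) := by
        rw [hγ.map_fst]; intro; infer_instance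
      rw [Measure.pi_map_pi (f := fun _ => Prod.fst) fun _ => measurable_fst.aemeasurable]
      simp only [hγ.map_fst]
    have hsnd : Measure.map (fun (z : Fin n → E × E) i => (z i).2) (Measure.pi fun _ => γ)
        = Measure.pi fun _ => ν := by
      have h0 : ∀ _i : Fin n, SigmaFinite (Measure.map Prod.snd γ) := by
        rw [hγ.map_snd]; intro; infer_instance
      rw [Measure.pi_map_pi (f := fun _ => Prod.snd) fun _ => measurable_snd.aemeasurable]
      simp only [hγ.map_snd]
    have hm1 : Measurable fun (z : Fin n → E × E) i => (z i).1 := by fun_prop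
    have hm2 : Measurable fun (z : Fin n → E × E) i => (z i).2 := by fun_prop
    have hWν := measurable_wassersteinDist_uniformMeasure (p := p) hp hn ν
    have hed : Measurable fun z : E × E => edist z.1 z.2 := measurable_edist
    calc expectedError p μ n
        = lintegralNorm p (fun z : Fin n → E × E =>
            wassersteinDist p (uniformMeasure fun i => (z i).1) μ) (Measure.pi fun _ => γ) := by
          rw [expectedError, ← hfst, lintegralNorm_map hm1.aemeasurable
            (measurable_wassersteinDist_uniformMeasure hp hn μ)]
      _ ≤ lintegralNorm p (fun z : Fin n → E × E =>
            (wassersteinDist p (uniformMeasure fun i => (z i).2) ν + wassersteinDist p μ ν)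
              + ((n : ℝ≥0∞)⁻¹ * ∑ i, edist (z i).1 (z i).2 ^ p) ^ (1 / p))
            (Measure.pi fun _ => γ) := by
          refine lintegralNorm_mono hp fun z => ?_
          have h1 := wassersteinDist_triangle_discrete hp (uniformMeasure fun i => (z i).1) μ
            (fun _ => (n : ℝ≥0∞)⁻¹) (fun i => (z i).2)
          have h2 := wassersteinDist_triangle_discrete hp (uniformMeasure fun i => (z i).2) μ
            (fun _ => (m : ℝ≥0∞)⁻¹) y
          rw [← uniformMeasure_eq_discreteMeasure] at h1 h2
          rw [← hν, wassersteinDist_comm ν] at h2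
          rw [add_comm]
          exact h1.trans (add_le_add (wassersteinDist_uniformMeasure_le hn _ _) h2)
      _ ≤ (lintegralNorm p (fun z : Fin n → E × E =>
            wassersteinDist p (uniformMeasure fun i => (z i).2) ν) (Measure.pi fun _ => γ)
            + wassersteinDist p μ ν) + lintegralNorm p (fun z => edist z.1 z.2) γ := by
          refine (lintegralNorm_add_le hp ((hWν.comp hm2).add_const _) ?_).trans
            (add_le_add ((lintegralNorm_add_le hp (hWν.comp hm2) measurable_const).trans_eq ?_) ?_)
          · fun_prop
          · rw [lintegralNorm_const hp]
            rfl
          · exact (lintegralNorm_eval_average γ hn hp hed).le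
      _ = _ := by
          rw [expectedError, ← hsnd, lintegralNorm_map hm2.aemeasurable
            (measurable_wassersteinDist_uniformMeasure hp hn _)]
  rw [two_mul, ← add_assoc]
  have hW : ∀ c, c + wassersteinDist p μ ν = ⨅ (γ : Measure (E × E)) (_ : IsCoupling μ ν γ),
      c + lintegralNorm p (fun z => edist z.1 z.2) γ := fun c => by
    simp only [wassersteinDist, lintegralNorm, ENNReal.add_iInf]
  rw [hW (expectedError p ν n + _)]
  exact le_iInf₂ key

end ExpectedError

/-! ### Sampling uniform labels -/

section Labels

/-- The uniform probability measure on `{0, …, m - 1}`. -/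
noncomputable def uniformFin (m : ℕ) : Measure (Fin m) := uniformMeasure id

theorem uniformMeasure_eq_map {E : Type*} [MeasurableSpace E] {m : ℕ} (y : Fin m → E) :
    uniformMeasure y = (uniformFin m).map y := by
  have hy : Measurable y := measurable_of_finite y
  rw [uniformFin, uniformMeasure, uniformMeasure, Measure.map_smul,
    Measure.map_finset_sum hy.aemeasurable]
  congr 1
  exact Finset.sum_congr rfl fun i _ => (Measure.map_dirac' hy _).symm

/-- Labels are sampled instead of points, so coinciding points remain distinguishable and classes of
labels modulo `M` make sense. -/
theorem expectedError_uniformMeasure {E : Type*} [MetricSpace E] [MeasurableSpace E]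
    [SecondCountableTopology E] [BorelSpace E] {p : ℝ} (hp : 1 ≤ p) {n m : ℕ} (hn : 0 < n)
    (hm : 0 < m) (y : Fin m → E) :
    expectedError p (uniformMeasure y) n
      = lintegralNorm p (fun l : Fin n → Fin m =>
          wassersteinDist p (uniformMeasure fun t => y (l t)) (uniformMeasure y))
        (Measure.pi fun _ => uniformFin m) := by
  have := isProbabilityMeasure_uniformMeasure hm (id : Fin m → Fin m)
  have h0 := isProbabilityMeasure_uniformMeasure hm y
  have hy : Measurable y := measurable_of_finite y
  have hmap : Measure.map (fun (l : Fin n → Fin m) t => y (l t)) (Measure.pi fun _ => uniformFin m)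
      = Measure.pi fun _ => uniformMeasure y := by
    rw [uniformMeasure_eq_map] at h0
    have : ∀ _i : Fin n, SigmaFinite (Measure.map y (uniformFin m)) := fun _ => inferInstance
    rw [Measure.pi_map_pi (f := fun _ => y) fun _ => hy.aemeasurable]
    simp only [← uniformMeasure_eq_map]
  rw [expectedError, ← hmap, lintegralNorm_map (measurable_of_finite _).aemeasurable
    (measurable_wassersteinDist_uniformMeasure hp hn _)]

theorem integral_uniformFin {m : ℕ} (f : Fin m → ℝ) :
    ∫ a, f a ∂(uniformFin m) = (m : ℝ)⁻¹ * ∑ a, f a := by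
  rw [uniformFin, uniformMeasure, integral_smul_measure, integral_finsetSum_measure]
  · simp
  · intro i _
    exact Integrable.of_finite

theorem sum_range_mul_of_periodic {M : Type*} [AddCommMonoid M] (f : ℕ → M) (a b : ℕ)
    (hf : ∀ l, f (l + a) = f l) : ∑ l ∈ Finset.range (a * b), f l = b • ∑ l ∈ Finset.range a, f l := by
  have hf' : ∀ b l, f (a * b + l) = f l := by
    intro b
    induction b with
    | zero => simp
    | succ b ih => intro l; rw [mul_add, mul_one, add_assoc, ih, add_comm, hf]
  induction b with
  | zero => simp
  | succ b ih =>
    rw [mul_add, mul_one, Finset.sum_range_add, ih, succ_nsmul]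
    simp only [hf']

theorem sum_fin_ite_mod_eq {M m : ℕ} (hM : M ∣ m) (hm : 0 < m) (r : ℕ) :
    ∑ a : Fin m, (if (a : ℕ) % M = r % M then (1 : ℝ) else 0) = m / M := by
  obtain ⟨k, rfl⟩ := hM
  have hM0 : 0 < M := Nat.pos_of_mul_pos_right hm
  rw [Fin.sum_univ_eq_sum_range (fun a => if a % M = r % M then (1 : ℝ) else 0),
    sum_range_mul_of_periodic _ _ _ (fun l => by simp)]
  have : ∀ l ∈ Finset.range M, (if l % M = r % M then (1 : ℝ) else 0)
      = if l = r % M then 1 else 0 := fun l hl => by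
    rw [Nat.mod_eq_of_lt (Finset.mem_range.1 hl)]
  rw [Finset.sum_congr rfl this, Finset.sum_ite_eq' , if_pos (Finset.mem_range.2 (Nat.mod_lt _ hM0))]
  have : (M : ℝ) ≠ 0 := Nat.cast_ne_zero.2 hM0.ne'
  push_cast
  field_simp
  simp

/-- The mean absolute value of a sum of independent centred variables. -/
theorem lintegral_abs_sum_le {α : Type*} [MeasurableSpace α] (u : Measure α)
    [IsProbabilityMeasure u] (n : ℕ) (ξ : α → ℝ) (hξ : MemLp ξ 2 u) (hξm : Measurable ξ)
    (h0 : ∫ a, ξ a ∂u = 0) :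
    ∫⁻ l, ENNReal.ofReal |∑ t : Fin n, ξ (l t)| ∂(Measure.pi fun _ : Fin n => u)
      ≤ ENNReal.ofReal √(n * ∫ a, ξ a ^ 2 ∂u) := by
  set Q := Measure.pi fun _ : Fin n => u with hQ
  have hmp : ∀ t : Fin n, MeasurePreserving (Function.eval t) Q u := fun t =>
    measurePreserving_eval (fun _ => u) t
  have hLp : ∀ t : Fin n, MemLp (fun l : Fin n → α => ξ (l t)) 2 Q := fun t =>
    hξ.comp_measurePreserving (hmp t)
  have hind : iIndepFun (fun (t : Fin n) (l : Fin n → α) => ξ (l t)) Q :=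
    iIndepFun_pi fun t => hξm.aemeasurable
  have hmean : ∀ t : Fin n, ∫ l, ξ (l t) ∂Q = 0 := fun t => by
    rw [← h0, ← (hmp t).map_eq, integral_map (hmp t).measurable.aemeasurable
      hξm.aestronglyMeasurable]
  have hsq : ∀ t : Fin n, ∫ l, ξ (l t) ^ 2 ∂Q = ∫ a, ξ a ^ 2 ∂u := fun t => by
    rw [← (hmp t).map_eq, integral_map (hmp t).measurable.aemeasurable
      (hξm.pow_const 2).aestronglyMeasurable]
  set S : (Fin n → α) → ℝ := fun l => ∑ t, ξ (l t) with hS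
  have hSLp : MemLp S 2 Q := memLp_finsetSum _ fun t _ => hLp t
  have hSint : Integrable S Q := hSLp.integrable (by norm_num)
  have hS0 : ∫ l, S l ∂Q = 0 := by
    rw [hS, integral_finsetSum _ fun t _ => (hLp t).integrable (by norm_num)]
    exact Finset.sum_eq_zero fun t _ => hmean t
  have hvar : ∫ l, S l ^ 2 ∂Q = n * ∫ a, ξ a ^ 2 ∂u := by
    have h1 := IndepFun.variance_sum (s := Finset.univ) (fun t _ => hLp t)
      (fun i _ j _ hij => hind.indepFun hij)
    have h2 : (∑ t : Fin n, fun l : Fin n → α => ξ (l t)) = S := by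
      ext l; simp [hS]
    rw [h2, variance_eq_sub hSLp, hS0] at h1
    simp only [variance_eq_sub (hLp _), hmean] at h1
    simp only [Pi.pow_apply, hsq] at h1
    simpa using h1
  -- Cauchy-Schwarz, read off from the nonnegative variance of `|S|`.
  have hjensen : (∫ l, |S l| ∂Q) ^ 2 ≤ ∫ l, S l ^ 2 ∂Q := by
    have h1 := variance_nonneg (fun l => |S l|) Q
    have h3 : MemLp (fun l => |S l|) 2 Q := hSLp.abs
    rw [variance_eq_sub h3] at h1
    simp only [Pi.pow_apply, sq_abs] at h1
    linarith
  rw [← ofReal_integral_eq_lintegral_ofReal hSint.abs (ae_of_all _ fun l => abs_nonneg _)]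
  refine ENNReal.ofReal_le_ofReal (Real.le_sqrt_of_sq_le ?_)
  rw [← hvar]
  exact hjensen

end Labels

/-! ### Chaining through label counts modulo `M` -/

section Chaining

/-- The mass at the leaf `i` when the labels `l` are counted modulo `M` and the mass of each class
is spread uniformly over its leaves. -/
noncomputable def levelWeight {n m : ℕ} (M : ℕ) (l : Fin n → Fin m) (i : Fin m) : ℝ :=
  M / (n * m) * ∑ t, if (l t : ℕ) % M = i % M then 1 else 0

theorem levelWeight_nonneg {n m : ℕ} (M : ℕ) (l : Fin n → Fin m) (i : Fin m) :
    0 ≤ levelWeight M l i :=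
  mul_nonneg (by positivity) (Finset.sum_nonneg fun _ _ => by split_ifs <;> norm_num)

/-- All `m / M` leaves that receive mass from the sample `t` lie in one class modulo `M'`. A coarse
class therefore carries its empirical frequency whatever `M` is, and two levels differ only by
transport inside the coarser classes. -/
theorem sum_levelWeight_fiber {n m M M' : ℕ} (hm : 0 < m) (hM : M ∣ m) (hM' : M' ∣ M)
    (l : Fin n → Fin m) (j : ℕ) :
    ∑ i ∈ Finset.univ.filter (fun i : Fin m => (i : ℕ) % M' = j), levelWeight M l i
      = (n : ℝ)⁻¹ * ∑ t, if (l t : ℕ) % M' = j then 1 else 0 := by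
  have hM0 : (M : ℝ) ≠ 0 := Nat.cast_ne_zero.2 (Nat.pos_of_dvd_of_pos hM hm).ne'
  have hm0 : (m : ℝ) ≠ 0 := Nat.cast_ne_zero.2 hm.ne'
  simp only [levelWeight, ← Finset.mul_sum]
  rw [Finset.sum_comm]
  have h : ∀ t, ∑ i ∈ Finset.univ.filter (fun i : Fin m => (i : ℕ) % M' = j), (if (l t : ℕ) % M = i % M then (1 : ℝ) else 0)
      = m / M * if (l t : ℕ) % M' = j then 1 else 0 := by
    intro t
    rw [Finset.sum_filter, ← sum_fin_ite_mod_eq hM hm (l t), Finset.sum_mul]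
    refine Finset.sum_congr rfl fun i _ => ?_
    by_cases h1 : (i : ℕ) % M = l t % M
    · have h2 : (i : ℕ) % M' = l t % M' := by
        rw [← Nat.mod_mod_of_dvd _ hM', h1, Nat.mod_mod_of_dvd _ hM']
      simp [h1, h2]
    · simp [h1, Ne.symm h1]
  simp only [h, ← Finset.mul_sum]
  rw [← mul_assoc]
  congr 1
  field_simp

theorem sum_levelWeight {n m M : ℕ} (hn : 0 < n) (hm : 0 < m) (hM : M ∣ m)
    (l : Fin n → Fin m) : ∑ i, levelWeight M l i = 1 := by
  have := sum_levelWeight_fiber hm hM (one_dvd M) l 0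
  simp only [Nat.mod_one, Finset.filter_true, if_true] at this
  rw [this]
  simp [hn.ne']

theorem sum_ofReal_levelWeight {n m M : ℕ} (hn : 0 < n) (hm : 0 < m) (hM : M ∣ m)
    (l : Fin n → Fin m) : ∑ i, ENNReal.ofReal (levelWeight M l i) = 1 := by
  rw [← ENNReal.ofReal_sum_of_nonneg fun i _ => levelWeight_nonneg M l i,
    sum_levelWeight hn hm hM, ENNReal.ofReal_one]

/-- The fine end of the chain: for `M = m` every class is a single leaf. The other end, `M = 1`,
gives the uniform weights (`levelWeight_one`). -/
theorem discreteMeasure_levelWeight_self {E : Type*} [MeasurableSpace E] {n m : ℕ} (hm : 0 < m)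
    (y : Fin m → E) (l : Fin n → Fin m) :
    discreteMeasure (fun i => ENNReal.ofReal (levelWeight m l i)) y
      = uniformMeasure fun t => y (l t) := by
  have hm0 : (m : ℝ) ≠ 0 := Nat.cast_ne_zero.2 hm.ne'
  have h : ∀ i, ENNReal.ofReal (levelWeight m l i)
      = (n : ℝ≥0∞)⁻¹ * ∑ t, if l t = i then 1 else 0 := by
    intro i
    have h1 : levelWeight m l i = (n : ℝ)⁻¹ * ∑ t, if l t = i then 1 else 0 := by
      simp only [levelWeight, Nat.mod_eq_of_lt (Fin.is_lt _), Fin.val_inj]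
      congr 1
      field_simp
    rcases Nat.eq_zero_or_pos n with rfl | hn
    · simp [levelWeight]
    · rw [h1, ENNReal.ofReal_mul (by positivity), ENNReal.ofReal_inv_of_pos (by positivity),
        ENNReal.ofReal_natCast, ENNReal.ofReal_sum_of_nonneg]
      · congr 1
        refine Finset.sum_congr rfl fun t _ => ?_
        split_ifs <;> simp
      · intro t _
        split_ifs <;> norm_num
  simp only [discreteMeasure, h, uniformMeasure]
  rw [Finset.smul_sum]
  simp only [Finset.mul_sum, Finset.sum_smul]
  rw [Finset.sum_comm]
  refine Finset.sum_congr rfl fun t _ => ?_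
  rw [Finset.sum_eq_single (l t)]
  · simp
  · intro i _ hi
    simp [Ne.symm hi]
  · simp

theorem levelWeight_one {n m : ℕ} (hn : 0 < n) (l : Fin n → Fin m) (i : Fin m) :
    levelWeight 1 l i = (m : ℝ)⁻¹ := by
  have hn0 : (n : ℝ) ≠ 0 := Nat.cast_ne_zero.2 hn.ne'
  simp only [levelWeight, Nat.mod_one, if_true]
  simp
  field_simp

/-- The difference is `1 / (n m)` times a sum of `n` independent copies of a centred variable `ξ` of
variance `M - M' ≤ M`, so its mean absolute value is at most `√(n M) / (n m)`. -/
theorem lintegral_abs_levelWeight_sub_le {n m M M' : ℕ} (hn : 0 < n) (hm : 0 < m) (hM : M ∣ m)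
    (hM' : M' ∣ M) (i : Fin m) :
    ∫⁻ l : Fin n → Fin m, ENNReal.ofReal |levelWeight M l i - levelWeight M' l i|
        ∂(Measure.pi fun _ => uniformFin m)
      ≤ (m : ℝ≥0∞)⁻¹ * ENNReal.ofReal √(M / n) := by
  have hu : IsProbabilityMeasure (uniformFin m) := isProbabilityMeasure_uniformMeasure hm _
  have hm0 : (m : ℝ) ≠ 0 := Nat.cast_ne_zero.2 hm.ne'
  have hn0 : (n : ℝ) ≠ 0 := Nat.cast_ne_zero.2 hn.ne'
  have hMpos : 0 < M := Nat.pos_of_dvd_of_pos hM hm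
  have hM0 : (M : ℝ) ≠ 0 := Nat.cast_ne_zero.2 hMpos.ne'
  have hM'0 : (M' : ℝ) ≠ 0 := Nat.cast_ne_zero.2 (Nat.pos_of_dvd_of_pos hM' hMpos).ne'
  let e : Fin m → ℝ := fun a => if (a : ℕ) % M = i % M then 1 else 0
  let e' : Fin m → ℝ := fun a => if (a : ℕ) % M' = i % M' then 1 else 0
  let ξ : Fin m → ℝ := fun a => M * e a - M' * e' a
  have he : ∑ a, e a = m / M := sum_fin_ite_mod_eq hM hm i
  have he' : ∑ a, e' a = m / M' := sum_fin_ite_mod_eq (hM'.trans hM) hm i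
  -- Since `M' ∣ M`, the class modulo `M` lies inside the class modulo `M'`, hence `e * e' = e`.
  have hee : ∀ a, ξ a ^ 2 = (M ^ 2 - 2 * M * M') * e a + M' ^ 2 * e' a := by
    intro a
    simp only [ξ, e, e']
    by_cases h1 : (a : ℕ) % M = i % M
    · have h2 : (a : ℕ) % M' = i % M' := by
        rw [← Nat.mod_mod_of_dvd _ hM', h1, Nat.mod_mod_of_dvd _ hM']
      simp only [h1, h2, if_true]
      ring
    · simp only [h1, if_false]
      split_ifs <;> ring
  have h0 : ∫ a, ξ a ∂(uniformFin m) = 0 := by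
    rw [integral_uniformFin]
    simp only [ξ, Finset.sum_sub_distrib, ← Finset.mul_sum, he, he']
    field_simp
    simp
  have h2 : ∫ a, ξ a ^ 2 ∂(uniformFin m) ≤ M := by
    rw [integral_uniformFin]
    simp only [hee, Finset.sum_add_distrib, ← Finset.mul_sum, he, he']
    have : (m : ℝ)⁻¹ * ((M ^ 2 - 2 * M * M') * (m / M) + M' ^ 2 * (m / M')) = M - M' := by
      field_simp
      ring
    rw [this]
    have : (0 : ℝ) ≤ M' := by positivity
    linarith
  have hξ : MemLp ξ 2 (uniformFin m) := MemLp.of_discrete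
  have key := lintegral_abs_sum_le (uniformFin m) n ξ hξ (measurable_of_finite _) h0
  have hdiff : ∀ l : Fin n → Fin m, levelWeight M l i - levelWeight M' l i
      = (m : ℝ)⁻¹ * ((n : ℝ)⁻¹ * ∑ t, ξ (l t)) := by
    intro l
    simp only [levelWeight, ξ, e, e', Finset.sum_sub_distrib, ← Finset.mul_sum]
    field_simp
  have habs : ∀ l : Fin n → Fin m, ENNReal.ofReal |levelWeight M l i - levelWeight M' l i|
      = (m : ℝ≥0∞)⁻¹ * ENNReal.ofReal (n : ℝ)⁻¹ * ENNReal.ofReal |∑ t, ξ (l t)| := by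
    intro l
    rw [hdiff, abs_mul, abs_mul, abs_of_nonneg (by positivity : 0 ≤ (m : ℝ)⁻¹),
      abs_of_nonneg (by positivity : 0 ≤ (n : ℝ)⁻¹), ENNReal.ofReal_mul (by positivity),
      ENNReal.ofReal_mul (by positivity), ENNReal.ofReal_inv_of_pos (by positivity),
      ENNReal.ofReal_natCast, mul_assoc]
  simp only [habs]
  rw [lintegral_const_mul _ (measurable_of_finite _), mul_assoc]
  refine mul_le_mul_right ((mul_le_mul_right key _).trans ?_) _
  rw [← ENNReal.ofReal_mul (by positivity)]
  refine ENNReal.ofReal_le_ofReal ?_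
  calc (n : ℝ)⁻¹ * √(n * ∫ a, ξ a ^ 2 ∂(uniformFin m))
      ≤ (n : ℝ)⁻¹ * √(n * M) := by gcongr
    _ = √(M / n) := by
        rw [show (M / n : ℝ) = (n : ℝ)⁻¹ ^ 2 * (n * M) by field_simp,
          Real.sqrt_mul (by positivity) ((n : ℝ) * M), Real.sqrt_sq (by positivity)]

variable {E : Type*} [MetricSpace E] [MeasurableSpace E] [SecondCountableTopology E]
  [BorelSpace E] {p : ℝ}

/-- The expected moved mass at a leaf is bounded uniformly in the leaf, so it factors out of the
cost and leaves the average distance from leaves to the centres of their classes. -/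
theorem lintegralNorm_levelWeight_step (hp : 1 ≤ p) {n m M M' : ℕ} (hn : 0 < n) (hm : 0 < m)
    (hM : M ∣ m) (hM' : M' ∣ M) (y : Fin m → E) (z : ℕ → E) :
    lintegralNorm p (fun l : Fin n → Fin m =>
        wassersteinDist p (discreteMeasure (fun i => ENNReal.ofReal (levelWeight M l i)) y)
          (discreteMeasure (fun i => ENNReal.ofReal (levelWeight M' l i)) y))
        (Measure.pi fun _ => uniformFin m)
      ≤ (2 ^ (p - 1) * ENNReal.ofReal √(M / n)) ^ (1 / p)
        * ((m : ℝ≥0∞)⁻¹ * ∑ i : Fin m, edist (y i) (z (i % M')) ^ p) ^ (1 / p) := by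
  have hp0 : 0 < p := by linarith
  rw [← ENNReal.mul_rpow_of_nonneg _ _ (by positivity)]
  refine ENNReal.rpow_le_rpow ?_ (by positivity)
  have hsub : ∀ (l : Fin n → Fin m) i,
      (ENNReal.ofReal (levelWeight M l i) - ENNReal.ofReal (levelWeight M' l i))
        + (ENNReal.ofReal (levelWeight M' l i) - ENNReal.ofReal (levelWeight M l i))
        = ENNReal.ofReal |levelWeight M l i - levelWeight M' l i| := by
    intro l i
    rw [← ENNReal.ofReal_sub _ (levelWeight_nonneg M' l i),
      ← ENNReal.ofReal_sub _ (levelWeight_nonneg M l i)]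
    rcases le_total (levelWeight M l i) (levelWeight M' l i) with h | h
    · rw [ENNReal.ofReal_of_nonpos (by linarith), zero_add, abs_of_nonpos (by linarith), neg_sub]
    · rw [ENNReal.ofReal_of_nonpos (by linarith : levelWeight M' l i - levelWeight M l i ≤ 0),
        add_zero, abs_of_nonneg (by linarith)]
  have hW : ∀ l : Fin n → Fin m,
      wassersteinDist p (discreteMeasure (fun i => ENNReal.ofReal (levelWeight M l i)) y)
          (discreteMeasure (fun i => ENNReal.ofReal (levelWeight M' l i)) y) ^ p
        ≤ 2 ^ (p - 1) * ∑ i : Fin m, ENNReal.ofReal |levelWeight M l i - levelWeight M' l i|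
          * edist (y i) (z (i % M')) ^ p := by
    intro l
    have h := wassersteinDist_discreteMeasure_le_of_fiber hp y (fun i : Fin m => (i : ℕ) % M') z
      (fun i => ENNReal.ofReal (levelWeight M l i)) (fun i => ENNReal.ofReal (levelWeight M' l i))
      (sum_ofReal_levelWeight hn hm hM l) (fun j => by
        rw [← ENNReal.ofReal_sum_of_nonneg fun i _ => levelWeight_nonneg M l i,
          ← ENNReal.ofReal_sum_of_nonneg fun i _ => levelWeight_nonneg M' l i,
          sum_levelWeight_fiber hm hM hM', sum_levelWeight_fiber hm (hM'.trans hM) dvd_rfl])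
    simp only [hsub] at h
    refine (ENNReal.rpow_le_rpow h hp0.le).trans_eq ?_
    rw [← ENNReal.rpow_mul, one_div_mul_cancel hp0.ne', ENNReal.rpow_one]
  refine (lintegral_mono hW).trans ?_
  rw [lintegral_const_mul _ (measurable_of_finite _), mul_assoc]
  refine mul_le_mul_right ?_ _
  rw [lintegral_finsetSum _ fun i _ => measurable_of_finite _, ← mul_assoc, mul_comm _ (m : ℝ≥0∞)⁻¹,
    Finset.mul_sum]
  refine Finset.sum_le_sum fun i _ => ?_
  rw [lintegral_mul_const _ (measurable_of_finite _)]
  exact mul_le_mul_left (lintegral_abs_levelWeight_sub_le hn hm hM hM' i) _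

theorem wassersteinDist_discreteMeasure_self (hp : 1 ≤ p) {ι : Type*} [Fintype ι] {w : ι → ℝ≥0∞}
    (y : ι → E) (hw : ∑ i, w i = 1) :
    wassersteinDist p (discreteMeasure w y) (discreteMeasure w y) = 0 := by
  classical
  have := wassersteinDist_discreteMeasure_le (p := p) (v := w) y y
    (fun i j => if i = j then w i else 0) (by simp) (by simp) hw
  have hp0 : 0 < p := by linarith
  simpa [hp0] using this

/-- Chaining along a sequence of levels. -/
theorem expectedError_uniformMeasure_le_sum (hp : 1 ≤ p) {n : ℕ} (hn : 0 < n) (M : ℕ → ℕ)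
    (hM0 : M 0 = 1) (hMpos : ∀ k, 0 < M k) (hM : ∀ k, M k ∣ M (k + 1)) (K : ℕ) (y : Fin (M K) → E)
    (z : ℕ → ℕ → E) :
    expectedError p (uniformMeasure y) n
      ≤ ∑ k ∈ Finset.range K, (2 ^ (p - 1) * ENNReal.ofReal √(M (k + 1) / n)) ^ (1 / p)
        * ((M K : ℝ≥0∞)⁻¹ * ∑ i : Fin (M K), edist (y i) (z k (i % M k)) ^ p) ^ (1 / p) := by
  have hdvd : ∀ k ≤ K, M k ∣ M K := fun k hk => by
    induction K, hk using Nat.le_induction with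
    | base => exact dvd_rfl
    -- The type of `y` depends on `K`, so the induction hypothesis asks for some family on `Fin (M
    -- K)`; a constant one will do.
    | succ K _ ih => exact (ih (fun i => y ⟨0, hMpos _⟩)).trans (hM K)
  let D : ℕ → (Fin n → Fin (M K)) → Measure E := fun k l =>
    discreteMeasure (fun i => ENNReal.ofReal (levelWeight (M k) l i)) y
  have hD0 : ∀ l, D 0 l = uniformMeasure y := fun l => by
    simp only [D, hM0, levelWeight_one hn]
    rw [uniformMeasure_eq_discreteMeasure, ENNReal.ofReal_inv_of_pos (Nat.cast_pos.2 (hMpos K)),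
      ENNReal.ofReal_natCast]
  have hDK : ∀ l, D K l = uniformMeasure fun t => y (l t) := fun l =>
    discreteMeasure_levelWeight_self (hMpos K) y l
  have hchain : ∀ (l : Fin n → Fin (M K)) (k : ℕ), k ≤ K → wassersteinDist p (D k l) (D 0 l)
      ≤ ∑ j ∈ Finset.range k, wassersteinDist p (D (j + 1) l) (D j l) := by
    intro l k
    induction k with
    | zero =>
      intro h0
      exact (wassersteinDist_discreteMeasure_self hp y
        (sum_ofReal_levelWeight hn (hMpos K) (hdvd 0 h0) l)).le
    | succ k ih =>
      intro hk
      rw [Finset.sum_range_succ, add_comm]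
      exact (wassersteinDist_triangle_discrete hp _ _ _ y).trans
        (add_le_add le_rfl (ih (by omega))) |>.trans_eq (add_comm _ _)
  rw [expectedError_uniformMeasure hp hn (hMpos K)]
  calc _ ≤ lintegralNorm p (fun l : Fin n → Fin (M K) =>
          ∑ j ∈ Finset.range K, wassersteinDist p (D (j + 1) l) (D j l))
          (Measure.pi fun _ => uniformFin (M K)) := by
        refine lintegralNorm_mono hp fun l => ?_
        rw [← hDK, ← hD0 l]
        exact hchain l K le_rfl
    _ ≤ _ := by
        refine (lintegralNorm_sum_le hp _ fun j => measurable_of_finite _).trans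
          (Finset.sum_le_sum fun k hk => ?_)
        exact lintegralNorm_levelWeight_step hp hn (hMpos K)
          (hdvd _ (Finset.mem_range.1 hk)) (hM k) y (z k)

end Chaining

/-! ### Average distance of periodic sequences -/

section AverageDistance

variable {E : Type*} [MetricSpace E] {p : ℝ}

/-- The `L^p` distance of two sequences of points over the indices below `m`. -/
noncomputable def avgEDist (p : ℝ) (m : ℕ) (x y : ℕ → E) : ℝ≥0∞ :=
  ((m : ℝ≥0∞)⁻¹ * ∑ i ∈ Finset.range m, edist (x i) (y i) ^ p) ^ (1 / p)

theorem avgEDist_triangle (hp : 1 ≤ p) (m : ℕ) (x y z : ℕ → E) :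
    avgEDist p m x z ≤ avgEDist p m x y + avgEDist p m y z := by
  have hp0 : 0 ≤ 1 / p := by positivity
  unfold avgEDist
  simp only [ENNReal.mul_rpow_of_nonneg _ _ hp0]
  rw [← mul_add]
  refine mul_le_mul_right (le_trans ?_ (ENNReal.Lp_add_le _ _ _ hp)) _
  exact ENNReal.rpow_le_rpow (Finset.sum_le_sum fun i _ =>
    ENNReal.rpow_le_rpow (edist_triangle _ _ _) (by linarith)) hp0

theorem avgEDist_self (hp : 1 ≤ p) (m : ℕ) (x : ℕ → E) : avgEDist p m x x = 0 := by
  have hp0 : 0 < p := by linarith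
  simp [avgEDist, hp0]

theorem avgEDist_comm (m : ℕ) (x y : ℕ → E) : avgEDist p m x y = avgEDist p m y x := by
  simp only [avgEDist, edist_comm]

theorem avgEDist_of_periodic {a m : ℕ} (hm : 0 < m) (ham : a ∣ m) {x y : ℕ → E}
    (hx : ∀ l, x (l + a) = x l) (hy : ∀ l, y (l + a) = y l) :
    avgEDist p m x y = avgEDist p a x y := by
  obtain ⟨b, rfl⟩ := ham
  have hb : (b : ℝ≥0∞) ≠ 0 := Nat.cast_ne_zero.2 (Nat.pos_of_mul_pos_left hm).ne'
  unfold avgEDist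
  rw [sum_range_mul_of_periodic _ _ _ fun l => by rw [hx, hy]]
  congr 1
  rw [nsmul_eq_mul, Nat.cast_mul, ENNReal.mul_inv (Or.inr (ENNReal.natCast_ne_top b)) (Or.inr hb),
    mul_assoc, ← mul_assoc _ (b : ℝ≥0∞), ENNReal.inv_mul_cancel hb (ENNReal.natCast_ne_top b),
    one_mul]

end AverageDistance

/-! ### The tree of quantizers and the multiscale bound -/

section Quantization

variable {E : Type*} [MetricSpace E] [MeasurableSpace E] {p : ℝ}

omit [MetricSpace E] in
theorem uniformMeasure_of_periodic {a m : ℕ} (hm : 0 < m) (ham : a ∣ m) {x : ℕ → E}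
    (hx : ∀ l, x (l + a) = x l) :
    uniformMeasure (fun i : Fin m => x i) = uniformMeasure (fun i : Fin a => x i) := by
  obtain ⟨b, rfl⟩ := ham
  have hb : (b : ℝ≥0∞) ≠ 0 := Nat.cast_ne_zero.2 (Nat.pos_of_mul_pos_left hm).ne'
  unfold uniformMeasure
  rw [Fin.sum_univ_eq_sum_range (fun i => Measure.dirac (x i)),
    Fin.sum_univ_eq_sum_range (fun i => Measure.dirac (x i)),
    sum_range_mul_of_periodic (fun i => Measure.dirac (x i)) _ _ fun l => by rw [hx],
    ← Nat.cast_smul_eq_nsmul ℝ≥0∞ b, smul_smul]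
  congr 1
  rw [Nat.cast_mul, ENNReal.mul_inv (Or.inr (ENNReal.natCast_ne_top b)) (Or.inr hb),
    mul_assoc, ENNReal.inv_mul_cancel hb (ENNReal.natCast_ne_top b), mul_one]

omit [MetricSpace E] in
theorem uniformMeasure_comp_perm {n : ℕ} (x : Fin n → E) (σ : Equiv.Perm (Fin n)) :
    uniformMeasure (fun i => x (σ i)) = uniformMeasure x := by
  unfold uniformMeasure
  rw [Equiv.sum_comp σ fun i => Measure.dirac (x i)]

/-- `f` is a periodic labelling of a discretization of `μ` by `m` points with error below `b`. -/
structure IsLabelling (p : ℝ) (μ : Measure E) (m : ℕ) (b : ℝ≥0∞) (f : ℕ → E) : Prop where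
  periodic : ∀ l, f (l + m) = f l
  error_lt : wassersteinDist p μ (uniformMeasure fun i : Fin m => f i) < b

theorem isLabelling_mod {μ : Measure E} {m : ℕ} {b : ℝ≥0∞} (hm : 0 < m) {x : Fin m → E}
    (hx : wassersteinDist p μ (uniformMeasure x) < b) :
    IsLabelling p μ m b fun l => x ⟨l % m, Nat.mod_lt _ hm⟩ := by
  refine ⟨fun l => by simp, ?_⟩
  have : (fun i : Fin m => x ⟨i % m, Nat.mod_lt _ hm⟩) = x := by
    ext i
    congr 1
    exact Fin.ext (Nat.mod_eq_of_lt i.2)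
  rwa [this]

theorem exists_isLabelling {μ : Measure E} {m : ℕ} {b : ℝ≥0∞} (hm : 0 < m)
    (hb : optimalUniformError p μ m < b) : ∃ f, IsLabelling p μ m b f := by
  obtain ⟨x, hx⟩ := iInf_lt_iff.1 hb
  exact ⟨_, isLabelling_mod hm hx⟩

variable [SecondCountableTopology E] [BorelSpace E]

/-- By periodicity `f` read on `m` labels still represents its old measure. It is matched with a
near-optimal `m`-point quantizer by a permutation, and permuting the labels of the latter does not
change its measure. -/
theorem IsLabelling.exists_refinement {μ : Measure E} [IsProbabilityMeasure μ] (hp : 1 ≤ p)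
    {a m : ℕ} {b b' : ℝ≥0∞} (hm : 0 < m) (ham : a ∣ m) {f : ℕ → E} (hf : IsLabelling p μ a b f)
    (hb : optimalUniformError p μ m < b') :
    ∃ g, IsLabelling p μ m b' g ∧ avgEDist p m f g ≤ b + b' := by
  obtain ⟨x, hx⟩ := iInf_lt_iff.1 hb
  obtain ⟨σ, hσ⟩ := exists_perm_le_wassersteinDist_add (μ := μ) hp hm (fun i : Fin m => f i) x
  have hx' : wassersteinDist p μ (uniformMeasure fun i => x (σ i)) < b' := by
    rwa [uniformMeasure_comp_perm]
  refine ⟨_, isLabelling_mod hm hx', ?_⟩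
  rw [uniformMeasure_of_periodic hm ham hf.periodic] at hσ
  refine le_trans (le_of_eq ?_) (hσ.trans (add_le_add hf.error_lt.le hx.le))
  unfold avgEDist
  rw [← Fin.sum_univ_eq_sum_range
    (fun i => edist (f i) (x (σ ⟨i % m, Nat.mod_lt _ hm⟩)) ^ p)]
  simp only [Nat.mod_eq_of_lt (Fin.is_lt _)]

/-- The multiscale bound for the expected error in terms of quantization errors. -/
theorem expectedError_le_sum (hp : 1 ≤ p) {μ : Measure E} [IsProbabilityMeasure μ] {n : ℕ}
    (hn : 0 < n) (M : ℕ → ℕ) (hM0 : M 0 = 1) (hMpos : ∀ k, 0 < M k) (hM : ∀ k, M k ∣ M (k + 1))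
    (b : ℕ → ℝ≥0∞) (hb : ∀ k, optimalUniformError p μ (M k) < b k) (K : ℕ) :
    expectedError p μ n ≤ 2 * b K
      + ∑ k ∈ Finset.range K, (2 ^ (p - 1) * ENNReal.ofReal √(M (k + 1) / n)) ^ (1 / p)
        * ∑ i ∈ Finset.Ico k K, (b i + b (i + 1)) := by
  have hdvd : ∀ j k, j ≤ k → M j ∣ M k := fun j k hk => by
    induction k, hk using Nat.le_induction with
    | base => exact dvd_rfl
    | succ K _ ih => exact ih.trans (hM K)
  obtain ⟨f₀, hf₀⟩ := exists_isLabelling (hMpos 0) (hb 0)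
  have hstep : ∀ k (f : {f : ℕ → E // IsLabelling p μ (M k) (b k) f}),
      ∃ g : {f : ℕ → E // IsLabelling p μ (M (k + 1)) (b (k + 1)) f},
        avgEDist p (M (k + 1)) f.1 g.1 ≤ b k + b (k + 1) := fun k f => by
    obtain ⟨g, hg, h⟩ := f.2.exists_refinement hp (hMpos _) (hM k) (hb (k + 1))
    exact ⟨⟨g, hg⟩, h⟩
  choose next hnext using hstep
  -- One coherent branch of refinements: each labelling is matched to its predecessor, so distances
  -- between distant levels telescope.
  let F : ∀ k, {f : ℕ → E // IsLabelling p μ (M k) (b k) f} := fun k =>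
    Nat.rec ⟨f₀, hf₀⟩ next k
  have hF : ∀ k, avgEDist p (M (k + 1)) (F k).1 (F (k + 1)).1 ≤ b k + b (k + 1) := fun k =>
    hnext k (F k)
  have hper : ∀ j k, j ≤ k → ∀ l, (F j).1 (l + M k) = (F j).1 l := by
    intro j k hjk l
    obtain ⟨c, hc⟩ := hdvd j k hjk
    have h : Function.Periodic (F j).1 (M j) := (F j).2.periodic
    rw [hc, mul_comm]
    exact h.nat_mul c l
  have havg : ∀ k j, k ≤ j → j ≤ K →
      avgEDist p (M K) (F k).1 (F j).1 ≤ ∑ i ∈ Finset.Ico k j, (b i + b (i + 1)) := by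
    intro k j hkj
    induction j, hkj using Nat.le_induction with
    | base => intro _; simp [avgEDist_self hp]
    | succ j hkj ih =>
      intro hjK
      rw [Finset.sum_Ico_succ_top hkj]
      refine (avgEDist_triangle hp _ _ _ _).trans (add_le_add (ih (by omega)) ?_)
      rw [avgEDist_of_periodic (hMpos K) (hdvd (j + 1) K hjK) (hper j (j + 1) (by omega))
        (hper (j + 1) (j + 1) le_rfl)]
      exact hF j
  set y : Fin (M K) → E := fun i => (F K).1 i with hy
  refine (expectedError_le_add hp hn (hMpos K) y).trans ?_
  rw [add_comm]
  refine add_le_add (mul_le_mul_right (F K).2.error_lt.le _) ?_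
  refine (expectedError_uniformMeasure_le_sum hp hn M hM0 hMpos hM K y fun k => (F k).1).trans ?_
  refine Finset.sum_le_sum fun k hk => mul_le_mul_right ?_ _
  have hkK : k ≤ K := (Finset.mem_range.1 hk).le
  refine le_trans (le_of_eq ?_) (havg k K hkK le_rfl)
  rw [avgEDist_comm, avgEDist, ← Fin.sum_univ_eq_sum_range
    (fun i => edist ((F K).1 i) ((F k).1 i) ^ p)]
  -- The centre used for a class at level `k` is the point of `F k` itself, the ancestor of all the
  -- leaves in the class.
  have h : ∀ i, (F k).1 (i % M k) = (F k).1 i := fun i => by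
    have h : Function.Periodic (F k).1 (M k) := (F k).2.periodic
    exact h.map_mod_nat i
  simp only [h, hy]

end Quantization

/-! ### Summation over geometric scales and the constant -/

section Multiscale

theorem expectedError_le_ofReal_sum {E : Type*} [MetricSpace E] [MeasurableSpace E]
    [SecondCountableTopology E] [BorelSpace E] {p : ℝ} (hp : 1 ≤ p) {μ : Measure E}
    [IsProbabilityMeasure μ] {n : ℕ} (hn : 0 < n) (M : ℕ → ℕ) (hM0 : M 0 = 1)
    (hMpos : ∀ k, 0 < M k) (hM : ∀ k, M k ∣ M (k + 1)) (v : ℕ → ℝ) (hv : ∀ k, 0 ≤ v k)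
    (hb : ∀ k, optimalUniformError p μ (M k) < ENNReal.ofReal (v k)) (K : ℕ) :
    expectedError p μ n ≤ ENNReal.ofReal (2 * v K + ∑ k ∈ Finset.range K,
      (2 ^ (p - 1)) ^ (1 / p) * (M (k + 1) / n) ^ (1 / (2 * p)) *
        ∑ i ∈ Finset.Ico k K, (v i + v (i + 1))) := by
  have hp0 : 0 < p := by linarith
  have hsum : ∀ k, 0 ≤ ∑ i ∈ Finset.Ico k K, (v i + v (i + 1)) := fun k =>
    Finset.sum_nonneg fun i _ => add_nonneg (hv _) (hv _)
  refine (expectedError_le_sum hp hn M hM0 hMpos hM _ hb K).trans_eq ?_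
  rw [ENNReal.ofReal_add (mul_nonneg zero_le_two (hv K))
    (Finset.sum_nonneg fun k _ => mul_nonneg (by positivity) (hsum k)),
    ENNReal.ofReal_mul zero_le_two, ENNReal.ofReal_ofNat,
    ENNReal.ofReal_sum_of_nonneg fun k _ => mul_nonneg (by positivity) (hsum k)]
  congr 1
  refine Finset.sum_congr rfl fun k _ => ?_
  rw [ENNReal.ofReal_mul (by positivity),
    ENNReal.ofReal_sum_of_nonneg fun i _ => add_nonneg (hv _) (hv _)]
  simp only [ENNReal.ofReal_add (hv _) (hv _)]
  congr 1
  have h2 : (2 : ℝ≥0∞) ^ (p - 1) = ENNReal.ofReal (2 ^ (p - 1)) := by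
    rw [← ENNReal.ofReal_rpow_of_pos two_pos, ENNReal.ofReal_ofNat]
  rw [h2, ← ENNReal.ofReal_mul (by positivity), ENNReal.ofReal_rpow_of_nonneg (by positivity)
    (by positivity), Real.mul_rpow (by positivity) (by positivity), Real.sqrt_eq_rpow,
    ← Real.rpow_mul (by positivity : 0 ≤ (M (k + 1) : ℝ) / n), show 1 / 2 * (1 / p) = 1 / (2 * p) by field_simp]

/-- After exchanging the sums, the link from level `i` to `i + 1` is weighted by a geometric sum
over `k ≤ i`, comparable to its last term. The link out of the root has a single term and is kept
apart, because `v 0 = A` is not controlled by the later values. -/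
theorem sum_range_mul_sum_Ico_le {c ω q A : ℝ} (hc : 0 ≤ c) (hω : 0 ≤ ω) (hq : 1 < q)
    {u v : ℕ → ℝ} (hu : ∀ k, 0 ≤ u k) (hanti : ∀ k, u (k + 1) ≤ u k) (hv0 : v 0 = A)
    (hv : ∀ k, v (k + 1) = u k) (J : ℕ) :
    ∑ k ∈ Finset.range (J + 1), c * (ω * q ^ k) * ∑ i ∈ Finset.Ico k (J + 1), (v i + v (i + 1))
      ≤ c * ω * (A + u 0) + 2 * c * (q ^ 2 / (q - 1)) * ∑ i ∈ Finset.range J, ω * q ^ i * u i := by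
  have hq1 : 0 < q - 1 := by linarith
  simp only [Finset.mul_sum]
  rw [Finset.range_eq_Ico, Finset.sum_Ico_Ico_comm, ← Finset.range_eq_Ico, Finset.sum_range_succ',
    add_comm]
  refine add_le_add (le_of_eq ?_) (Finset.sum_le_sum fun i _ => ?_)
  · simp [hv0, hv]
  · rw [← Finset.sum_mul, ← Finset.range_eq_Ico, ← Finset.mul_sum, ← Finset.mul_sum,
      geom_sum_eq hq.ne', hv, hv]
    have h1 : (q ^ (i + 1 + 1) - 1) / (q - 1) ≤ q ^ (i + 2) / (q - 1) := by
      gcongr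
      linarith
    have h2 : u i + u (i + 1) ≤ 2 * u i := by linarith [hanti i]
    calc c * (ω * ((q ^ (i + 1 + 1) - 1) / (q - 1))) * (u i + u (i + 1))
        ≤ c * (ω * (q ^ (i + 2) / (q - 1))) * (2 * u i) := by
          have := hu i
          have := hu (i + 1)
          gcongr
      _ = _ := by
          rw [pow_add]
          ring

theorem sum_range_pow_sub_le {s : ℝ} (hs : 1 < s) (J : ℕ) :
    ∑ i ∈ Finset.range J, (s⁻¹) ^ (J - i) ≤ 1 / (s - 1) := by
  have h1 : ∑ i ∈ Finset.range J, (s⁻¹) ^ (J - i) = ∑ j ∈ Finset.range J, (s⁻¹) ^ (j + 1) := by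
    rw [← Finset.sum_range_reflect]
    refine Finset.sum_congr rfl fun i hi => ?_
    congr 1
    have := Finset.mem_range.1 hi
    omega
  have hs0 : 0 < s := by linarith
  have hs1 : s - 1 ≠ 0 := by linarith
  have h2 : (s⁻¹) < 1 := inv_lt_one_of_one_lt₀ hs
  rw [h1]
  simp only [pow_succ, ← Finset.sum_mul]
  rw [geom_sum_eq h2.ne]
  have h3 : 0 ≤ (s⁻¹) ^ J := by positivity
  have h4 : ((s⁻¹) ^ J - 1) / (s⁻¹ - 1) * s⁻¹ = (1 - (s⁻¹) ^ J) / (s - 1) := by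
    have : s⁻¹ - 1 ≠ 0 := by linarith
    field_simp
    have : 1 - s ≠ 0 := by linarith
    field_simp
    ring
  rw [h4]
  have : 0 < s - 1 := by linarith
  gcongr
  linarith

/-- Bernoulli gives `2 ^ (1 - 1/p) ≤ 2 - 1/p`, and `p + 1/p ≥ 2`. A bound linear in `p` is what the
factor `p` in `two_mul_log_two_le_rpow_sub_one` can absorb. -/
theorem two_rpow_rpow_le {p : ℝ} (hp : 1 ≤ p) : ((2 : ℝ) ^ (p - 1)) ^ (1 / p) ≤ p := by
  have hp0 : 0 < p := by linarith
  have h1 : 1 / p ≤ 1 := by rw [div_le_one hp0]; exact hp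
  have h2 : 0 < 1 / p := by positivity
  rw [← Real.rpow_mul zero_le_two, show (p - 1) * (1 / p) = 1 - 1 / p by field_simp]
  have h := rpow_one_add_le_one_add_mul_self (s := 1) (by norm_num)
    (by linarith : 0 ≤ 1 - 1 / p) (by linarith)
  norm_num at h
  refine (le_of_eq (by norm_num)).trans (h.trans ?_)
  have h3 : p + 1 / p - 2 = (p - 1) ^ 2 / p := by field_simp; ring
  have h4 : 0 ≤ (p - 1) ^ 2 / p := by positivity
  have : p⁻¹ = 1 / p := by simp
  linarith

/-- This follows from `p ≤ ⌈p⌉₊ ≤ 2 * p`: the scale ratio is chosen so that its power `1/(2p)` stays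
in a range free of `p`. -/
theorem rpow_base_mem {p : ℝ} (hp : 1 ≤ p) :
    2 ≤ ((4 : ℝ) ^ ⌈p⌉₊) ^ (1 / (2 * p)) ∧ ((4 : ℝ) ^ ⌈p⌉₊) ^ (1 / (2 * p)) ≤ 4 := by
  have hp0 : 0 < p := by linarith
  have h1 := Nat.le_ceil p
  have h2 := Nat.ceil_lt_add_one hp0.le
  rw [← Real.rpow_natCast, ← Real.rpow_mul (by norm_num)]
  have h3 : (4 : ℝ) ^ (1 / 2 : ℝ) = 2 := by
    rw [← Real.sqrt_eq_rpow, show (4 : ℝ) = 2 ^ 2 by norm_num, Real.sqrt_sq (by norm_num)]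
  constructor
  · conv_lhs => rw [← h3]
    refine Real.rpow_le_rpow_of_exponent_le (by norm_num) ?_
    rw [mul_one_div, div_le_div_iff₀ (by norm_num) (by positivity)]
    linarith
  · conv_rhs => rw [← Real.rpow_one 4]
    refine Real.rpow_le_rpow_of_exponent_le (by norm_num) ?_
    rw [mul_one_div, div_le_one (by positivity)]
    linarith

theorem two_mul_log_two_le_rpow_sub_one {p δ : ℝ} (hδ : 0 < δ) :
    2 * p * δ * Real.log 2 ≤ ((4 : ℝ) ^ ⌈p⌉₊) ^ δ - 1 := by
  have h1 := Nat.le_ceil p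
  have hl : 0 < Real.log 2 := Real.log_pos (by norm_num)
  have h4 : Real.log 4 = 2 * Real.log 2 := by
    rw [show (4 : ℝ) = 2 ^ 2 by norm_num, Real.log_pow]; norm_num
  rw [Real.rpow_def_of_pos (by positivity), Real.log_pow, h4]
  have h2 := Real.add_one_le_exp (⌈p⌉₊ * (2 * Real.log 2) * δ)
  have h3 : 2 * p * δ * Real.log 2 ≤ ⌈p⌉₊ * (2 * Real.log 2) * δ := by
    calc 2 * p * δ * Real.log 2 = p * (2 * Real.log 2) * δ := by ring
      _ ≤ _ := by gcongr
  linarith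

/-- On `[2, 4]` the quotient `q^2 / (q - 1)` is largest at `q = 4`, with value `16/3`. The factors
`p` cancel, leaving `16 / (3 log 2) < 39/5`. -/
theorem multiscale_constant_le {p δ q c s : ℝ} (hp : 1 ≤ p) (hδ : 0 < δ)
    (hq : 2 ≤ q) (hq' : q ≤ 4) (hcp : c ≤ p)
    (hs : 2 * p * δ * Real.log 2 ≤ s - 1) :
    2 * c * (q ^ 2 / (q - 1)) * (1 / (s - 1)) ≤ (39 / 5) / δ := by
  have hl : 0.6931471803 < Real.log 2 := Real.log_two_gt_d9
  have hl0 : 0 < Real.log 2 := by linarith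
  have hp0 : 0 < p := by linarith
  have h1 : q ^ 2 / (q - 1) ≤ 16 / 3 := by
    rw [div_le_div_iff₀ (by linarith) (by norm_num)]
    nlinarith
  have h2 : 1 / (s - 1) ≤ 1 / (2 * p * δ * Real.log 2) :=
    one_div_le_one_div_of_le (by positivity) hs
  calc 2 * c * (q ^ 2 / (q - 1)) * (1 / (s - 1))
      ≤ 2 * p * (16 / 3) * (1 / (2 * p * δ * Real.log 2)) := by
        have : 0 < 2 * p * δ * Real.log 2 := by positivity
        have h5 : 0 < s - 1 := this.trans_le hs
        have : 0 < q - 1 := by linarith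
        gcongr
    _ = (16 / 3 / Real.log 2) / δ := by field_simp
    _ ≤ (39 / 5) / δ := by
        refine div_le_div_of_nonneg_right ?_ hδ.le
        rw [div_le_iff₀ hl0]
        linarith

/-- A quantitative form of the upper bound: if the quantization error is below `C m^(-β)` from
`N` on, then the expected error is at most `(19 / 2) C / (1 / (2 p) - β) n^(-β)`, up to a term of
order `n^(-1/(2 p))`. -/
theorem expectedError_le_of_optimalUniformError_lt {E : Type*} [MetricSpace E] [MeasurableSpace E]
    [SecondCountableTopology E] [BorelSpace E] {p : ℝ} (hp : 1 ≤ p) {μ : Measure E}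
    [IsProbabilityMeasure μ] {β C A : ℝ} (hβ : 0 ≤ β) (hβp : β < 1 / (2 * p)) (hC : 0 ≤ C)
    (hA : 0 ≤ A) (hb1 : optimalUniformError p μ 1 < ENNReal.ofReal A) {N : ℕ} (hN : 0 < N)
    (hb : ∀ m ≥ N, optimalUniformError p μ m < ENNReal.ofReal (C * (m : ℝ) ^ (-β))) :
    ∃ R : ℝ, ∀ n ≥ N, expectedError p μ n ≤ ENNReal.ofReal
      ((19 / 2) * C / (1 / (2 * p) - β) * (n : ℝ) ^ (-β) + R * (n : ℝ) ^ (-(1 / (2 * p)))) := by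
  have hp0 : 0 < p := by linarith
  set θ : ℝ := 1 / (2 * p) with hθ
  have hθ0 : 0 < θ := by positivity
  have hθ2 : θ ≤ 1 / 2 := by
    rw [hθ, div_le_div_iff₀ (by positivity) (by norm_num)]; linarith
  set δ : ℝ := θ - β with hδ
  have hδ0 : 0 < δ := by rw [hδ]; linarith
  set r : ℕ := 4 ^ ⌈p⌉₊ with hr
  have hrR : (r : ℝ) = 4 ^ ⌈p⌉₊ := by rw [hr]; push_cast; rfl
  have hr1 : 1 < r := Nat.one_lt_pow (Nat.ceil_pos.2 hp0).ne' (by norm_num)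
  have hr0 : 0 < (r : ℝ) := by exact_mod_cast (by omega : 0 < r)
  set q : ℝ := (r : ℝ) ^ θ with hq
  obtain ⟨hq2, hq4⟩ : 2 ≤ q ∧ q ≤ 4 := by rw [hq, hrR]; exact rpow_base_mem hp
  set c : ℝ := ((2 : ℝ) ^ (p - 1)) ^ (1 / p) with hc
  have hc0 : 0 ≤ c := by positivity
  set s : ℝ := (r : ℝ) ^ δ with hs
  have hslog : 2 * p * δ * Real.log 2 ≤ s - 1 := by
    rw [hs, hrR]; exact two_mul_log_two_le_rpow_sub_one hδ0
  have hs1 : 1 < s := by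
    have : 0 < 2 * p * δ * Real.log 2 := by
      have := Real.log_pos (by norm_num : (1 : ℝ) < 2)
      positivity
    linarith
  refine ⟨c * ((r : ℝ) * N) ^ θ * (A + C), fun n hn => ?_⟩
  have hn0 : 0 < n := by omega
  have hnR : 0 < (n : ℝ) := by exact_mod_cast hn0
  -- The scales are `m₀ * r ^ j` for `j ≤ J`: the first lies in `[N, r N)`, where the hypothesis on
  -- the quantization error already applies, and the last in `[n/2, n]`.
  set J := Nat.log r (n / N) with hJ
  have hdiv : n / N ≠ 0 := (Nat.div_pos hn hN).ne'
  have hrJ : 0 < r ^ J := by positivity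
  have hJ1 : r ^ J * N ≤ n := (Nat.le_div_iff_mul_le hN).1 (Nat.pow_log_le_self r hdiv)
  have hJ2 : n < r ^ (J + 1) * N := (Nat.div_lt_iff_lt_mul hN).1 (Nat.lt_pow_succ_log_self hr1 _)
  set m₀ := n / r ^ J with hm₀
  have hm₀N : N ≤ m₀ := (Nat.le_div_iff_mul_le hrJ).2 (by rwa [mul_comm] at hJ1)
  have hm₀r : m₀ < r * N := (Nat.div_lt_iff_lt_mul hrJ).2 (by
    calc n < r ^ (J + 1) * N := hJ2
      _ = r * N * r ^ J := by ring)
  have hm₀n : m₀ * r ^ J ≤ n := Nat.div_mul_le_self _ _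
  have hnm₀ : n ≤ 2 * (m₀ * r ^ J) := by
    have h1 : n < r ^ J * (m₀ + 1) := Nat.lt_mul_div_succ n hrJ
    have h2 : r ^ J * 1 ≤ r ^ J * m₀ := Nat.mul_le_mul_left _ (by omega)
    calc n ≤ r ^ J * (m₀ + 1) := h1.le
      _ = r ^ J * m₀ + r ^ J * 1 := by ring
      _ ≤ r ^ J * m₀ + r ^ J * m₀ := by omega
      _ = _ := by ring
  have hm₀0 : 0 < m₀ := by omega
  have hm₀R : 0 < (m₀ : ℝ) := by exact_mod_cast hm₀0
  let M : ℕ → ℕ := fun k => Nat.casesOn k 1 fun j => m₀ * r ^ j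
  let u : ℕ → ℝ := fun j => C * ((m₀ * r ^ j : ℕ) : ℝ) ^ (-β)
  let v : ℕ → ℝ := fun k => Nat.casesOn k A u
  have hrpos : ∀ j, 0 < r ^ j := fun j => by positivity
  have hMpos : ∀ k, 0 < M k := by
    rintro (_ | j)
    · exact one_pos
    · exact Nat.mul_pos hm₀0 (hrpos j)
  have hM : ∀ k, M k ∣ M (k + 1) := by
    rintro (_ | j)
    · exact one_dvd _
    · exact Nat.mul_dvd_mul_left _ (pow_dvd_pow r (Nat.le_succ j))
  have hu : ∀ k, 0 ≤ u k := fun k => by positivity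
  have hv : ∀ k, 0 ≤ v k := by
    rintro (_ | j)
    · exact hA
    · exact hu j
  have hbv : ∀ k, optimalUniformError p μ (M k) < ENNReal.ofReal (v k) := by
    rintro (_ | j)
    · exact hb1
    · exact hb _ (hm₀N.trans (Nat.le_mul_of_pos_right _ (hrpos j)))
  have hanti : ∀ k, u (k + 1) ≤ u k := by
    intro k
    refine mul_le_mul_of_nonneg_left (Real.rpow_le_rpow_of_nonpos ?_ ?_ (by linarith)) hC
    · exact_mod_cast Nat.mul_pos hm₀0 (hrpos k)
    · exact_mod_cast Nat.mul_le_mul_left _ (Nat.pow_le_pow_right (by omega) (Nat.le_succ k))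
  refine (expectedError_le_ofReal_sum hp hn0 M rfl hMpos hM v hv hbv (J + 1)).trans
    (ENNReal.ofReal_le_ofReal ?_)
  set ω : ℝ := ((m₀ : ℝ) / n) ^ θ with hω
  have hω0 : 0 ≤ ω := by positivity
  have hMω : ∀ k, ((M (k + 1) : ℝ) / n) ^ (1 / (2 * p)) = ω * q ^ k := by
    intro k
    have : (M (k + 1) : ℝ) / n = m₀ / n * (r : ℝ) ^ k := by
      simp only [M]; push_cast; ring
    rw [this, Real.mul_rpow (by positivity) (by positivity), hω, hq, ← Real.rpow_natCast,
      ← Real.rpow_natCast, ← Real.rpow_mul hr0.le, ← Real.rpow_mul hr0.le, mul_comm (k : ℝ)]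
  -- The left side is `C n^(-β) (m₀ r^i / n)^δ`, and `m₀ r^J ≤ n`. As `δ > 0`, the terms decay
  -- geometrically away from the top scale.
  have hterm : ∀ i ≤ J, ω * q ^ i * u i ≤ C * (n : ℝ) ^ (-β) * (s⁻¹) ^ (J - i) := by
    intro i hi
    have hri : 0 < (r : ℝ) ^ i := by positivity
    have h1 : ω * q ^ i * u i = C * (n : ℝ) ^ (-β) * ((m₀ * (r : ℝ) ^ i) / n) ^ δ := by
      rw [← hMω]
      simp only [u, M]
      push_cast
      have hx : 0 < m₀ * (r : ℝ) ^ i := by positivity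
      rw [Real.div_rpow hx.le hnR.le, Real.div_rpow hx.le hnR.le, hδ, Real.rpow_sub hx,
        Real.rpow_sub hnR, Real.rpow_neg hx.le, Real.rpow_neg hnR.le]
      have := Real.rpow_pos_of_pos hnR β
      rw [← hθ]
      field_simp
    rw [h1]
    refine mul_le_mul_of_nonneg_left ?_ (by positivity)
    have h2 : (s⁻¹) ^ (J - i) = (((r : ℝ) ^ (J - i))⁻¹) ^ δ := by
      rw [hs, ← Real.inv_rpow hr0.le, ← Real.rpow_natCast, ← Real.rpow_mul (by positivity),
        ← inv_pow, ← Real.rpow_natCast, ← Real.rpow_mul (by positivity), mul_comm]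
    rw [h2]
    refine Real.rpow_le_rpow (by positivity) ?_ hδ0.le
    rw [div_le_iff₀ hnR, ← div_eq_inv_mul, le_div_iff₀ (by positivity), mul_assoc, ← pow_add,
      Nat.add_sub_cancel' hi]
    exact_mod_cast hm₀n
  -- As `m₀ < r N` is bounded independently of `n`, the link out of the root is only of order
  -- `n^(-θ)`, which is what `R` records.
  have hroot : c * ω * (A + u 0) ≤ c * ((r : ℝ) * N) ^ θ * (A + C) * (n : ℝ) ^ (-θ) := by
    have h1 : ω ≤ ((r : ℝ) * N) ^ θ * (n : ℝ) ^ (-θ) := by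
      rw [hω, Real.div_rpow hm₀R.le hnR.le, Real.rpow_neg hnR.le, ← div_eq_mul_inv]
      gcongr
      exact_mod_cast hm₀r.le
    have h2 : u 0 ≤ C := by
      simp only [u, pow_zero, mul_one]
      refine mul_le_of_le_one_right hC (Real.rpow_le_one_of_one_le_of_nonpos ?_ (by linarith))
      exact_mod_cast hm₀0
    have := hu 0
    calc c * ω * (A + u 0) ≤ c * (((r : ℝ) * N) ^ θ * (n : ℝ) ^ (-θ)) * (A + C) := by gcongr
      _ = _ := by ring
  have hlast : 2 * u J ≤ 3 * C * (n : ℝ) ^ (-β) := by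
    have h1 : ((m₀ * r ^ J : ℕ) : ℝ) ^ (-β) ≤ ((n : ℝ) / 2) ^ (-β) := by
      refine Real.rpow_le_rpow_of_nonpos (by positivity) ?_ (by linarith)
      rw [div_le_iff₀ two_pos, mul_comm]
      exact_mod_cast hnm₀
    have h2 : ((n : ℝ) / 2) ^ (-β) ≤ (3 / 2) * (n : ℝ) ^ (-β) := by
      rw [Real.div_rpow hnR.le zero_le_two, Real.rpow_neg zero_le_two, div_inv_eq_mul, mul_comm]
      refine mul_le_mul_of_nonneg_right ?_ (by positivity)
      calc (2 : ℝ) ^ β ≤ 2 ^ (1 / 2 : ℝ) :=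
            Real.rpow_le_rpow_of_exponent_le (by norm_num) (by linarith)
        _ ≤ 3 / 2 := by
            rw [← Real.sqrt_eq_rpow, Real.sqrt_le_left (by norm_num)]
            norm_num
    calc 2 * u J ≤ 2 * (C * ((3 / 2) * (n : ℝ) ^ (-β))) := by
          simp only [u]
          gcongr
          exact h1.trans h2
      _ = _ := by ring
  have hsum := sum_range_mul_sum_Ico_le hc0 hω0 (by linarith : 1 < q) hu hanti
    (rfl : v 0 = A) (fun k => rfl) J
  have hgeom : ∑ i ∈ Finset.range J, ω * q ^ i * u i ≤ C * (n : ℝ) ^ (-β) * (1 / (s - 1)) := by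
    refine (Finset.sum_le_sum fun i hi => hterm i (Finset.mem_range.1 hi).le).trans ?_
    rw [← Finset.mul_sum]
    exact mul_le_mul_of_nonneg_left (sum_range_pow_sub_le hs1 J) (by positivity)
  have hconst := multiscale_constant_le hp hδ0 hq2 hq4 (two_rpow_rpow_le hp) hslog
  -- The discretization error is absorbed using `δ ≤ 1/2`; the sum `3/2 + 39/5` is below `19/2`.
  have h3 : (3 : ℝ) ≤ (3 / 2) / δ := by
    rw [le_div_iff₀ hδ0]
    have : δ ≤ 1 / 2 := by rw [hδ]; linarith
    linarith
  have hX : 0 ≤ C * (n : ℝ) ^ (-β) := by positivity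
  simp only [hMω]
  calc 2 * v (J + 1) + ∑ k ∈ Finset.range (J + 1),
        c * (ω * q ^ k) * ∑ i ∈ Finset.Ico k (J + 1), (v i + v (i + 1))
      ≤ 3 * C * (n : ℝ) ^ (-β) + (c * ((r : ℝ) * N) ^ θ * (A + C) * (n : ℝ) ^ (-θ)
        + 2 * c * (q ^ 2 / (q - 1)) * (C * (n : ℝ) ^ (-β) * (1 / (s - 1)))) := by
        refine add_le_add hlast (hsum.trans (add_le_add hroot ?_))
        refine mul_le_mul_of_nonneg_left hgeom ?_
        have : 0 < q - 1 := by linarith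
        positivity
    _ = (3 + 2 * c * (q ^ 2 / (q - 1)) * (1 / (s - 1))) * (C * (n : ℝ) ^ (-β))
        + c * ((r : ℝ) * N) ^ θ * (A + C) * (n : ℝ) ^ (-θ) := by ring
    _ ≤ ((3 / 2) / δ + (39 / 5) / δ) * (C * (n : ℝ) ^ (-β))
        + c * ((r : ℝ) * N) ^ θ * (A + C) * (n : ℝ) ^ (-θ) := by gcongr
    _ ≤ _ := by
        refine add_le_add ?_ le_rfl
        have h5 : ((3 / 2) / δ + (39 / 5) / δ) ≤ (19 / 2) / δ := by
          rw [← add_div]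
          gcongr
          norm_num
        calc _ ≤ (19 / 2) / δ * (C * (n : ℝ) ^ (-β)) := by gcongr
          _ = _ := by ring

end Multiscale

/-! ### The lower rate `n^(-1/2)` -/

section LowerBound

theorem lintegral_le_lintegralNorm {α : Type*} [MeasurableSpace α] {μ : Measure α}
    [IsProbabilityMeasure μ] {p : ℝ} (hp : 1 ≤ p) {f : α → ℝ≥0∞} (hf : Measurable f) :
    ∫⁻ x, f x ∂μ ≤ lintegralNorm p f μ := by
  have := eLpNorm'_le_eLpNorm'_of_exponent_le zero_lt_one hp μ hf.aestronglyMeasurable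
  simpa [eLpNorm', lintegralNorm] using this

/-- Moments of a sum of independent centred variables bounded by `1`. -/
theorem moments_sum_of_iIndepFun {Ω ι : Type*} [MeasurableSpace Ω] {P : Measure Ω}
    [IsProbabilityMeasure P] {Y : ι → Ω → ℝ} (hY : ∀ i, Measurable (Y i)) (hind : iIndepFun Y P)
    (hbd : ∀ i ω, |Y i ω| ≤ 1) {v : ℝ} (hmean : ∀ i, ∫ ω, Y i ω ∂P = 0)
    (hvar : ∀ i, ∫ ω, Y i ω ^ 2 ∂P = v) (s : Finset ι) :
    ∫ ω, (∑ i ∈ s, Y i ω) ^ 2 ∂P = s.card * v ∧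
      ∫ ω, (∑ i ∈ s, Y i ω) ^ 4 ∂P ≤ 3 * (s.card : ℝ) ^ 2 := by
  classical
  have hSm : ∀ t : Finset ι, Measurable fun ω => ∑ i ∈ t, Y i ω := fun t =>
    Finset.measurable_fun_sum t fun i _ => hY i
  have hSbd : ∀ (t : Finset ι) ω, |∑ i ∈ t, Y i ω| ≤ t.card := fun t ω => by
    refine (Finset.abs_sum_le_sum_abs _ _).trans ((Finset.sum_le_sum fun i _ => hbd i ω).trans ?_)
    simp
  have hint : ∀ (t : Finset ι) (a : ι) (j k : ℕ),
      Integrable (fun ω => (∑ i ∈ t, Y i ω) ^ j * Y a ω ^ k) P := fun t a j k => by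
    refine Integrable.of_bound (((hSm t).pow_const j).mul
      ((hY a).pow_const k)).aestronglyMeasurable ((t.card : ℝ) ^ j * 1 ^ k) (ae_of_all _ fun ω => ?_)
    rw [Real.norm_eq_abs, abs_mul, abs_pow, abs_pow]
    have := hSbd t ω
    have := hbd a ω
    gcongr
  have hintY : ∀ (a : ι) (k : ℕ), Integrable (fun ω => Y a ω ^ k) P := fun a k => by
    simpa using hint ∅ a 0 k
  have hS0 : ∀ t : Finset ι, ∫ ω, ∑ i ∈ t, Y i ω ∂P = 0 := fun t => by
    rw [integral_finsetSum _ fun i _ => by simpa using hintY i 1]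
    exact Finset.sum_eq_zero fun i _ => hmean i
  have hle : ∀ a (k : ℕ), ∫ ω, Y a ω ^ k ∂P ≤ 1 := fun a k => by
    have h1 : ∫ ω, Y a ω ^ k ∂P ≤ ∫ _, (1 : ℝ) ∂P := by
      refine integral_mono (hintY a k) (integrable_const _) fun ω => ?_
      exact (le_abs_self _).trans (by rw [abs_pow]; exact pow_le_one₀ (abs_nonneg _) (hbd a ω))
    simpa using h1
  induction s using Finset.induction_on with
  | empty => simp
  | insert a s ha ih =>
    obtain ⟨ih2, ih4⟩ := ih
    set S : Ω → ℝ := fun ω => ∑ i ∈ s, Y i ω with hS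
    have hSY : S ⟂ᵢ[P] Y a := by
      have := hind.indepFun_finsetSum_of_notMem hY ha
      convert this using 1
      ext ω
      simp [hS]
    have hprod : ∀ j k : ℕ, ∫ ω, S ω ^ j * Y a ω ^ k ∂P
        = (∫ ω, S ω ^ j ∂P) * ∫ ω, Y a ω ^ k ∂P := fun j k => by
      have h1 : (fun ω => S ω ^ j) ⟂ᵢ[P] (fun ω => Y a ω ^ k) :=
        hSY.comp (φ := fun x : ℝ => x ^ j) (ψ := fun x : ℝ => x ^ k)
          (by fun_prop) (by fun_prop)
      exact h1.integral_mul_eq_mul_integral ((hSm s).pow_const j).aestronglyMeasurable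
        ((hY a).pow_const k).aestronglyMeasurable
    have hmean' : ∫ ω, S ω ∂P = 0 := hS0 s
    have hv0 : 0 ≤ v := by rw [← hvar a]; exact integral_nonneg fun ω => sq_nonneg _
    have hv1 : v ≤ 1 := by rw [← hvar a]; exact hle a 2
    have hins : ∀ ω, ∑ i ∈ insert a s, Y i ω = S ω + Y a ω := fun ω => by
      rw [Finset.sum_insert ha, add_comm]
    simp only [hins, Finset.card_insert_of_notMem ha]
    have i : ∀ j k : ℕ, Integrable (fun ω => S ω ^ j * Y a ω ^ k) P := hint s a
    have e2 : ∫ ω, (S ω + Y a ω) ^ 2 ∂P = (∫ ω, S ω ^ 2 ∂P) + v := by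
      have h1 : ∀ ω, (S ω + Y a ω) ^ 2 = S ω ^ 2 * Y a ω ^ 0
          + (2 * (S ω ^ 1 * Y a ω ^ 1) + S ω ^ 0 * Y a ω ^ 2) := fun ω => by ring
      simp only [h1]
      have i1 : Integrable (fun ω => 2 * (S ω ^ 1 * Y a ω ^ 1) + S ω ^ 0 * Y a ω ^ 2) P :=
        ((i 1 1).const_mul 2).add (i 0 2)
      rw [integral_add (i 2 0) i1,
        integral_add ((i 1 1).const_mul 2) (i 0 2), integral_const_mul, hprod, hprod, hprod, hvar]
      simp [hmean', hmean]
    -- Independence and centring kill the terms containing `S` or `Y a` to the first power. The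
    -- induction then closes by `3 k^2 + 6 k + 1 ≤ 3 (k + 1)^2`.
    have e4 : ∫ ω, (S ω + Y a ω) ^ 4 ∂P = (∫ ω, S ω ^ 4 ∂P)
        + 6 * ((∫ ω, S ω ^ 2 ∂P) * v) + ∫ ω, Y a ω ^ 4 ∂P := by
      have h1 : ∀ ω, (S ω + Y a ω) ^ 4 = S ω ^ 4 * Y a ω ^ 0
          + (4 * (S ω ^ 3 * Y a ω ^ 1) + (6 * (S ω ^ 2 * Y a ω ^ 2)
            + (4 * (S ω ^ 1 * Y a ω ^ 3) + S ω ^ 0 * Y a ω ^ 4))) := fun ω => by ring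
      simp only [h1]
      have i1 : Integrable (fun ω => 4 * (S ω ^ 1 * Y a ω ^ 3) + S ω ^ 0 * Y a ω ^ 4) P :=
        ((i 1 3).const_mul 4).add (i 0 4)
      have i2 : Integrable (fun ω => 6 * (S ω ^ 2 * Y a ω ^ 2)
          + (4 * (S ω ^ 1 * Y a ω ^ 3) + S ω ^ 0 * Y a ω ^ 4)) P := ((i 2 2).const_mul 6).add i1
      have i3 : Integrable (fun ω => 4 * (S ω ^ 3 * Y a ω ^ 1) + (6 * (S ω ^ 2 * Y a ω ^ 2)
          + (4 * (S ω ^ 1 * Y a ω ^ 3) + S ω ^ 0 * Y a ω ^ 4))) P := ((i 3 1).const_mul 4).add i2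
      rw [integral_add (i 4 0) i3, integral_add ((i 3 1).const_mul 4) i2,
        integral_add ((i 2 2).const_mul 6) i1, integral_add ((i 1 3).const_mul 4) (i 0 4),
        integral_const_mul, integral_const_mul, integral_const_mul, hprod, hprod, hprod, hprod,
        hprod, hvar]
      simp [hmean', hmean]
      ring
    refine ⟨by rw [e2, ih2]; push_cast; ring, ?_⟩
    rw [e4, ih2]
    have h4 := hle a 4
    have hk : (0 : ℝ) ≤ s.card := by positivity
    have h5 : (s.card : ℝ) * v * v ≤ s.card * 1 * 1 := by gcongr
    push_cast
    nlinarith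

/-- Pointwise this is `t^2 - t^4 ≤ t` for `t = |S| / a ≥ 0`. It bounds the first absolute moment
below once the fourth moment is controlled by the square of the second. -/
theorem le_integral_abs_of_moments {Ω : Type*} [MeasurableSpace Ω] {P : Measure Ω}
    {S : Ω → ℝ} (h1 : Integrable S P) (h2 : Integrable (fun ω => S ω ^ 2) P)
    (h4 : Integrable (fun ω => S ω ^ 4) P) {a : ℝ} (ha : 0 < a) :
    (∫ ω, S ω ^ 2 ∂P) / a - (∫ ω, S ω ^ 4 ∂P) / a ^ 3 ≤ ∫ ω, |S ω| ∂P := by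
  rw [← integral_div, ← integral_div, ← integral_sub (h2.div_const _) (h4.div_const _)]
  refine integral_mono ((h2.div_const _).sub (h4.div_const _)) h1.abs fun ω => ?_
  have hs : S ω ^ 4 = |S ω| ^ 4 := by rw [← abs_pow, abs_of_nonneg (by positivity)]
  simp only
  rw [hs, ← sq_abs (S ω)]
  obtain ⟨t, ht0, ht⟩ : ∃ t, 0 ≤ t ∧ |S ω| = a * t :=
    ⟨|S ω| / a, by positivity, by field_simp⟩
  rw [ht]
  have h : (a * t) ^ 2 / a - (a * t) ^ 4 / a ^ 3 = a * (t ^ 2 - t ^ 4) := by field_simp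
  rw [h]
  refine mul_le_mul_of_nonneg_left ?_ ha.le
  rcases le_total t 1 with h | h
  · nlinarith [pow_nonneg ht0 4]
  · nlinarith [pow_le_pow_right₀ h (by norm_num : 2 ≤ 4)]

variable {E : Type*} [MetricSpace E] [MeasurableSpace E] [BorelSpace E] {p : ℝ}

omit [MeasurableSpace E] [BorelSpace E] in
theorem continuous_truncated_dist (a : E) : Continuous fun x : E => min (dist x a) 1 := by
  fun_prop

omit [BorelSpace E] in
/-- A measure which is not a point mass is seen by some truncated distance function. -/
theorem exists_truncated_dist_not_ae_const [TopologicalSpace.SeparableSpace E] {μ : Measure E}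
    [IsProbabilityMeasure μ] (hdirac : ∀ x : E, μ ≠ Measure.dirac x) :
    ∃ a : E, ∀ m : ℝ, ¬ ∀ᵐ x ∂μ, min (dist x a) 1 = m := by
  by_contra! hcon
  have hne : Nonempty E := nonempty_of_isProbabilityMeasure μ
  choose m hm using hcon
  have hall : ∀ᵐ x ∂μ, ∀ k, min (dist x (TopologicalSpace.denseSeq E k)) 1
      = m (TopologicalSpace.denseSeq E k) := ae_all_iff.2 fun k => hm _
  obtain ⟨x₀, hx₀⟩ := hall.exists
  refine hdirac x₀ ?_
  have hae : ∀ᵐ x ∂μ, x = x₀ := by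
    filter_upwards [hall] with x hx
    -- Both sides are continuous in `a` and agree on a dense sequence; the value at `a = x₀` then
    -- forces `x = x₀`.
    have h1 : ∀ a, min (dist x a) 1 = min (dist x₀ a) 1 := by
      have h2 : (fun a => min (dist x a) 1) = fun a => min (dist x₀ a) 1 :=
        Continuous.ext_on (TopologicalSpace.denseRange_denseSeq E) (by fun_prop) (by fun_prop) (by
          rintro _ ⟨k, rfl⟩
          simp only [hx, hx₀])
      exact congr_fun h2
    have h3 := h1 x₀
    rw [dist_self] at h3
    have h4 : min (dist x x₀) 1 = 0 := by rw [h3]; simp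
    rcases min_choice (dist x x₀) 1 with h | h
    · exact dist_eq_zero.1 (h ▸ h4)
    · rw [h] at h4; norm_num at h4
  have h0 : μ {x₀}ᶜ = 0 := by
    rw [ae_iff] at hae
    exact hae
  ext s hs
  rw [Measure.dirac_apply' _ hs]
  by_cases hx : x₀ ∈ s
  · have hsub : sᶜ ⊆ {x₀}ᶜ := Set.compl_subset_compl.2 (Set.singleton_subset_iff.2 hx)
    have h5 : μ sᶜ = 0 := measure_mono_null hsub h0
    have := prob_compl_eq_zero_iff hs |>.1 h5
    simpa [hx] using this
  · have hsub : s ⊆ {x₀}ᶜ := Set.subset_compl_singleton_iff.2 hx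
    have h5 : μ s = 0 := measure_mono_null hsub h0
    simpa [hx] using h5

variable [SecondCountableTopology E]

/-- The easy half of Kantorovich duality: under any coupling the difference of integrals is at most
the mean distance, hence at most the `L^p` cost. -/
theorem ofReal_abs_integral_sub_le_wassersteinDist (hp : 1 ≤ p) {μ ν : Measure E}
    (f : E → ℝ) (hf : Measurable f) {C : ℝ} (hC : ∀ x, |f x| ≤ C)
    (hLip : ∀ x y, |f x - f y| ≤ dist x y) :
    ENNReal.ofReal |∫ x, f x ∂μ - ∫ x, f x ∂ν| ≤ wassersteinDist p μ ν := by
  refine le_iInf₂ fun γ hγ => ?_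
  have := hγ.isProbabilityMeasure
  have h1 : ∫ x, f x ∂μ = ∫ z, f z.1 ∂γ := by
    rw [← hγ.map_fst, integral_map measurable_fst.aemeasurable hf.aestronglyMeasurable]
  have h2 : ∫ x, f x ∂ν = ∫ z, f z.2 ∂γ := by
    rw [← hγ.map_snd, integral_map measurable_snd.aemeasurable hf.aestronglyMeasurable]
  have i1 : Integrable (fun z : E × E => f z.1) γ :=
    Integrable.of_bound (hf.comp measurable_fst).aestronglyMeasurable C (ae_of_all _ fun z => hC _)
  have i2 : Integrable (fun z : E × E => f z.2) γ :=
    Integrable.of_bound (hf.comp measurable_snd).aestronglyMeasurable C (ae_of_all _ fun z => hC _)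
  rw [h1, h2, ← integral_sub i1 i2, ← Real.enorm_eq_ofReal_abs]
  refine (enorm_integral_le_lintegral_enorm _).trans ((lintegral_mono fun z => ?_).trans
    (lintegral_le_lintegralNorm hp measurable_edist))
  rw [Real.enorm_eq_ofReal_abs, edist_dist]
  exact ENNReal.ofReal_le_ofReal (hLip _ _)

omit [MetricSpace E] [BorelSpace E] [SecondCountableTopology E] in
theorem integral_uniformMeasure {n : ℕ} (x : Fin n → E) (f : E → ℝ) (hf : Measurable f) :
    ∫ e, f e ∂(uniformMeasure x) = (n : ℝ)⁻¹ * ∑ i, f (x i) := by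
  rw [uniformMeasure_eq_map, integral_map (measurable_of_finite _).aemeasurable
    hf.aestronglyMeasurable, integral_uniformFin]

/-- The empirical measure of a measure which is not a point mass converges at most at the rate
`n^(-1/2)`. -/
theorem exists_le_expectedError (hp : 1 ≤ p) {μ : Measure E} [IsProbabilityMeasure μ]
    (hdirac : ∀ x : E, μ ≠ Measure.dirac x) :
    ∃ c : ℝ, 0 < c ∧ ∀ n : ℕ, 0 < n →
      ENNReal.ofReal (c * (n : ℝ) ^ (-(1 / 2) : ℝ)) ≤ expectedError p μ n := by
  obtain ⟨a, ha⟩ := exists_truncated_dist_not_ae_const hdirac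
  set f : E → ℝ := fun x => min (dist x a) 1 with hf
  have hfm : Measurable f := (continuous_truncated_dist a).measurable
  have hf0 : ∀ x, 0 ≤ f x := fun x => le_min dist_nonneg zero_le_one
  have hf1 : ∀ x, f x ≤ 1 := fun x => min_le_right _ _
  have hfi : Integrable f μ := Integrable.of_bound hfm.aestronglyMeasurable 1
    (ae_of_all _ fun x => by rw [Real.norm_eq_abs, abs_of_nonneg (hf0 x)]; exact hf1 x)
  have hLip : ∀ x y, |f x - f y| ≤ dist x y := fun x y =>
    (abs_min_sub_min_le_max _ _ _ _).trans (by simpa using abs_dist_sub_le x y a)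
  set m : ℝ := ∫ x, f x ∂μ with hm
  have hm0 : 0 ≤ m := integral_nonneg hf0
  have hm1 : m ≤ 1 := by
    have := integral_mono hfi (integrable_const (1 : ℝ)) hf1
    simpa using this
  set g : E → ℝ := fun x => f x - m with hg
  have hgm : Measurable g := hfm.sub_const m
  have hgbd : ∀ x, |g x| ≤ 1 := fun x => by
    rw [abs_le]
    constructor <;> simp only [hg] <;> linarith [hf0 x, hf1 x]
  have hg2i : Integrable (fun x => g x ^ 2) μ :=
    Integrable.of_bound (hgm.pow_const 2).aestronglyMeasurable 1 (ae_of_all _ fun x => by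
      rw [Real.norm_eq_abs, abs_pow]; exact pow_le_one₀ (abs_nonneg _) (hgbd x))
  set v : ℝ := ∫ x, g x ^ 2 ∂μ with hv
  have hv0 : 0 < v := by
    refine lt_of_le_of_ne (integral_nonneg fun x => sq_nonneg _) fun h => ha m ?_
    have := (integral_eq_zero_iff_of_nonneg (fun x => sq_nonneg (g x)) hg2i).1 h.symm
    filter_upwards [this] with x hx
    have h1 : g x = 0 := by simpa using hx
    simp only [hg] at h1
    exact sub_eq_zero.1 h1
  have hgmean : ∫ x, g x ∂μ = 0 := by
    simp only [hg]
    rw [integral_sub hfi (integrable_const _)]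
    simp [hm]
  -- With truncation level `a = √n * k`, this `k` makes the fourth-moment term exactly half of the
  -- second-moment term.
  set k : ℝ := √(6 / v) with hk
  have hk0 : 0 < k := Real.sqrt_pos.2 (by positivity)
  have hk2 : k ^ 2 = 6 / v := Real.sq_sqrt (by positivity)
  refine ⟨v / (2 * k), by positivity, fun n hn => ?_⟩
  have hnR : 0 < (n : ℝ) := by exact_mod_cast hn
  set Q := Measure.pi fun _ : Fin n => μ with hQ
  have hmp : ∀ t : Fin n, MeasurePreserving (Function.eval t) Q μ := fun t =>
    measurePreserving_eval (fun _ => μ) t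
  set Y : Fin n → (Fin n → E) → ℝ := fun t x => g (x t) with hY
  have hYm : ∀ t, Measurable (Y t) := fun t => hgm.comp (measurable_pi_apply t)
  have hind : iIndepFun Y Q := iIndepFun_pi fun t => hgm.aemeasurable
  have hmean : ∀ t, ∫ x, Y t x ∂Q = 0 := fun t => by
    rw [← hgmean, ← (hmp t).map_eq, integral_map (hmp t).measurable.aemeasurable
      hgm.aestronglyMeasurable]
  have hvar : ∀ t, ∫ x, Y t x ^ 2 ∂Q = v := fun t => by
    rw [hv, ← (hmp t).map_eq, integral_map (hmp t).measurable.aemeasurable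
      (hgm.pow_const 2).aestronglyMeasurable]
  obtain ⟨hS2, hS4⟩ := moments_sum_of_iIndepFun hYm hind (fun t x => hgbd _) hmean hvar Finset.univ
  rw [Finset.card_univ, Fintype.card_fin] at hS2 hS4
  set S : (Fin n → E) → ℝ := fun x => ∑ t, Y t x with hS
  have hSm : Measurable S := Finset.measurable_fun_sum _ fun t _ => hYm t
  have hSbd : ∀ x, |S x| ≤ n := fun x => by
    refine (Finset.abs_sum_le_sum_abs _ _).trans
      ((Finset.sum_le_sum fun t _ => hgbd (x t)).trans ?_)
    simp
  have hSi : ∀ j : ℕ, Integrable (fun x => S x ^ j) Q := fun j =>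
    Integrable.of_bound (hSm.pow_const j).aestronglyMeasurable ((n : ℝ) ^ j)
      (ae_of_all _ fun x => by
        rw [Real.norm_eq_abs, abs_pow]; exact pow_le_pow_left₀ (abs_nonneg _) (hSbd x) j)
  have hSi1 : Integrable S Q := by simpa using hSi 1
  have hsq : √(n : ℝ) ^ 2 = n := Real.sq_sqrt hnR.le
  have hsq0 : 0 < √(n : ℝ) := Real.sqrt_pos.2 hnR
  have hlow : v / (2 * k) * √(n : ℝ) ≤ ∫ x, |S x| ∂Q := by
    refine le_trans ?_ (le_integral_abs_of_moments hSi1 (hSi 2) (hSi 4)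
      (by positivity : 0 < √(n : ℝ) * k))
    rw [hS2]
    have h3 : (∫ x, S x ^ 4 ∂Q) / (√(n : ℝ) * k) ^ 3 ≤ 3 * (n : ℝ) ^ 2 / (√(n : ℝ) * k) ^ 3 := by
      gcongr
    have h4 : 3 * (n : ℝ) ^ 2 / (√(n : ℝ) * k) ^ 3 = v / (2 * k) * √(n : ℝ) := by
      have h5 : (√(n : ℝ) * k) ^ 3 = n * √(n : ℝ) * (6 / v) * k := by
        rw [← hk2, ← hsq, Real.sqrt_sq hsq0.le]; ring
      rw [h5, div_eq_iff (by positivity)]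
      field_simp
      rw [hsq]
      ring
    have h6 : (n : ℝ) * v / (√(n : ℝ) * k) = 2 * (v / (2 * k) * √(n : ℝ)) := by
      field_simp
      rw [hsq]
    linarith
  calc ENNReal.ofReal (v / (2 * k) * (n : ℝ) ^ (-(1 / 2) : ℝ))
      ≤ ENNReal.ofReal ((n : ℝ)⁻¹ * ∫ x, |S x| ∂Q) := by
        refine ENNReal.ofReal_le_ofReal ?_
        have h7 : v / (2 * k) * (n : ℝ) ^ (-(1 / 2) : ℝ) = (n : ℝ)⁻¹ * (v / (2 * k) * √(n : ℝ)) := by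
          rw [Real.rpow_neg hnR.le, ← Real.sqrt_eq_rpow]
          field_simp
          rw [hsq]
        rw [h7]
        gcongr
    _ = ∫⁻ x, ENNReal.ofReal ((n : ℝ)⁻¹ * |S x|) ∂Q := by
        rw [← integral_const_mul, ofReal_integral_eq_lintegral_ofReal (hSi1.abs.const_mul _)
          (ae_of_all _ fun x => by positivity)]
    _ ≤ ∫⁻ x, wassersteinDist p (uniformMeasure x) μ ∂Q := by
        refine lintegral_mono fun x => ?_
        refine le_trans (le_of_eq ?_) (ofReal_abs_integral_sub_le_wassersteinDist hp f hfm
          (C := 1) (fun x => by rw [abs_of_nonneg (hf0 x)]; exact hf1 x) hLip)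
        rw [integral_uniformMeasure x f hfm, ← hm]
        have h8 : (n : ℝ)⁻¹ * ∑ i, f (x i) - m = (n : ℝ)⁻¹ * S x := by
          simp only [hS, hY, hg, Finset.sum_sub_distrib]
          simp
          field_simp
        rw [h8, abs_mul, abs_of_pos (inv_pos.2 hnR)]
    _ ≤ expectedError p μ n :=
        lintegral_le_lintegralNorm hp (measurable_wassersteinDist_uniformMeasure hp hn μ)

end LowerBound

/-! ### Exponents and weighted upper limits -/

section PolynomialExponent

theorem polynomialExponent_mono {a b : ℕ → ℝ≥0∞} (h : ∀ᶠ n in atTop, a n ≤ b n) :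
    polynomialExponent a ≤ polynomialExponent b := by
  refine limsup_le_limsup ?_
  filter_upwards [h, eventually_ge_atTop 1] with n hn h1
  refine EReal.div_le_div_right_of_nonneg ?_ (ENNReal.log_monotone hn)
  exact_mod_cast Real.log_nonneg (by exact_mod_cast h1)

theorem polynomialExponent_ofReal_mul_rpow {c : ℝ} (hc : 0 < c) (s : ℝ) :
    polynomialExponent (fun n => ENNReal.ofReal (c * (n : ℝ) ^ s)) = s := by
  have hlog : Tendsto (fun n : ℕ => Real.log n) atTop atTop :=
    Real.tendsto_log_atTop.comp tendsto_natCast_atTop_atTop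
  have hlim : Tendsto (fun n : ℕ => Real.log c / Real.log n + s) atTop (𝓝 (0 + s)) :=
    (hlog.const_div_atTop _).add_const s
  rw [zero_add] at hlim
  refine Tendsto.limsup_eq (Tendsto.congr' ?_ (continuous_coe_real_ereal.continuousAt.tendsto.comp
    hlim))
  filter_upwards [eventually_gt_atTop 1] with n hn
  have hn0 : 0 < (n : ℝ) := by exact_mod_cast (by omega : 0 < n)
  have hl : 0 < Real.log n := Real.log_pos (by exact_mod_cast hn)
  rw [ENNReal.log_ofReal_of_pos (by positivity), ← EReal.coe_div, Function.comp_apply,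
    Real.log_mul hc.ne' (by positivity), Real.log_rpow hn0]
  congr 1
  field_simp

theorem natCast_rpow_eq_ofReal {n : ℕ} (β : ℝ) (hn : 0 < n) :
    (n : ℝ≥0∞) ^ β = ENNReal.ofReal ((n : ℝ) ^ β) := by
  rw [← ENNReal.ofReal_rpow_of_pos (by exact_mod_cast hn), ENNReal.ofReal_natCast]

theorem lt_ofReal_of_rpow_mul_lt {a : ℝ≥0∞} {n : ℕ} (hn : 0 < n) {β C : ℝ}
    (h : (n : ℝ≥0∞) ^ β * a < ENNReal.ofReal C) : a < ENNReal.ofReal (C * (n : ℝ) ^ (-β)) := by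
  have hnR : 0 < (n : ℝ) := by exact_mod_cast hn
  have hpos : 0 < (n : ℝ) ^ β := by positivity
  rw [natCast_rpow_eq_ofReal β hn, mul_comm, ← ENNReal.lt_div_iff_mul_lt (Or.inl (by simpa))
    (Or.inl ENNReal.ofReal_ne_top), ← ENNReal.ofReal_div_of_pos hpos] at h
  rwa [Real.rpow_neg hnR.le, ← div_eq_mul_inv]

theorem polynomialExponent_le_of_limsup_lt_top {a : ℕ → ℝ≥0∞} {β : ℝ}
    (h : limsup (fun n : ℕ => (n : ℝ≥0∞) ^ β * a n) atTop < ∞) :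
    polynomialExponent a ≤ ((-β : ℝ) : EReal) := by
  obtain ⟨D, hD, hDt⟩ := exists_between h
  have hev := eventually_lt_of_limsup_lt hD
  have hD1 : D < ENNReal.ofReal (D.toReal + 1) := by
    rw [ENNReal.lt_ofReal_iff_toReal_lt hDt.ne]
    linarith
  rw [← polynomialExponent_ofReal_mul_rpow (by positivity : 0 < D.toReal + 1)]
  refine polynomialExponent_mono ?_
  filter_upwards [hev, eventually_gt_atTop 0] with n hn h0
  exact (lt_ofReal_of_rpow_mul_lt h0 (hn.trans hD1)).le

theorem limsup_rpow_mul_le_one_of_polynomialExponent_lt {a : ℕ → ℝ≥0∞} {z : ℝ}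
    (h : polynomialExponent a < z) :
    limsup (fun n : ℕ => (n : ℝ≥0∞) ^ (-z) * a n) atTop ≤ 1 := by
  refine limsup_le_of_le (h := ?_)
  filter_upwards [eventually_lt_of_limsup_lt h, eventually_gt_atTop 1] with n hn h1
  have hn0 : 0 < n := by omega
  have hnR : 0 < (n : ℝ) := by exact_mod_cast hn0
  have hl : 0 < Real.log n := Real.log_pos (by exact_mod_cast h1)
  rw [EReal.div_lt_iff (by exact_mod_cast hl) (EReal.coe_ne_top _), ← EReal.coe_mul,
    ← Real.log_rpow hnR, ← ENNReal.log_ofReal_of_pos (by positivity), ENNReal.log_lt_log_iff] at hn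
  calc (n : ℝ≥0∞) ^ (-z) * a n ≤ (n : ℝ≥0∞) ^ (-z) * ENNReal.ofReal ((n : ℝ) ^ z) := by gcongr
    _ = 1 := by
        rw [natCast_rpow_eq_ofReal _ hn0, ← ENNReal.ofReal_mul (by positivity),
          ← Real.rpow_add hnR, neg_add_cancel, Real.rpow_zero, ENNReal.ofReal_one]

end PolynomialExponent

/-! ### Proof of the upper bounds -/

section Main

variable {E : Type*} [MetricSpace E] [SecondCountableTopology E] [MeasurableSpace E]
  [BorelSpace E] {p : ℝ} {μ : Measure E} [IsProbabilityMeasure μ]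

theorem wassersteinDist_le_moment {n : ℕ} (hn : 0 < n) (x₀ : E) :
    wassersteinDist p μ (uniformMeasure fun _ : Fin n => x₀)
      ≤ (∫⁻ x, edist x x₀ ^ p ∂μ) ^ (1 / p) := by
  have hd : uniformMeasure (fun _ : Fin n => x₀) = Measure.dirac x₀ := by
    simp only [uniformMeasure, Finset.sum_const, Finset.card_univ, Fintype.card_fin]
    rw [← Nat.cast_smul_eq_nsmul ℝ≥0∞, smul_smul, ENNReal.inv_mul_cancel
      (Nat.cast_ne_zero.2 hn.ne') (ENNReal.natCast_ne_top n), one_smul]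
  have hγ : IsCoupling μ (Measure.dirac x₀) (μ.prod (Measure.dirac x₀)) := by
    refine ⟨inferInstance, ?_, ?_⟩
    · rw [Measure.map_fst_prod, measure_univ, one_smul]
    · rw [Measure.map_snd_prod, measure_univ, one_smul]
  rw [hd]
  refine (wassersteinDist_le hγ).trans_eq ?_
  rw [lintegralNorm, lintegral_prod _ (measurable_edist.pow_const p).aemeasurable]
  congr 1
  refine lintegral_congr fun x => ?_
  rw [lintegral_dirac]

theorem HasFiniteMoment.exists_optimalUniformError_le (hp : 1 ≤ p) (h : HasFiniteMoment p μ) :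
    ∃ A : ℝ, 0 ≤ A ∧ ∀ n, 0 < n → optimalUniformError p μ n < ENNReal.ofReal A := by
  obtain ⟨x₀, hx₀⟩ := h
  have hfin : (∫⁻ x, edist x x₀ ^ p ∂μ) ^ (1 / p) ≠ ∞ :=
    ENNReal.rpow_ne_top_of_nonneg (by positivity) hx₀.ne
  refine ⟨((∫⁻ x, edist x x₀ ^ p ∂μ) ^ (1 / p)).toReal + 1, by positivity, fun n hn => ?_⟩
  refine ((iInf_le _ fun _ : Fin n => x₀).trans (wassersteinDist_le_moment hn x₀)).trans_lt ?_
  rw [ENNReal.lt_ofReal_iff_toReal_lt hfin]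
  linarith

theorem optimalUniformError_le_expectedError (hp : 1 ≤ p) (n : ℕ) :
    optimalUniformError p μ n ≤ expectedError p μ n := by
  rw [← lintegralNorm_const (μ := Measure.pi fun _ : Fin n => μ) hp (optimalUniformError p μ n)]
  refine lintegralNorm_mono hp fun x => ?_
  rw [wassersteinDist_comm]
  exact iInf_le _ x

/-- The quantitative bound is applied with any `C` above the limsup `B`; after multiplication by
`n^β` its remainder tends to zero, and then `C` decreases to `B`. Strictness of `C > B` provides the
strict error bounds needed because optimal quantizers may not exist. -/
theorem limsup_expectedError_le (hp : 1 ≤ p) (hmoment : HasFiniteMoment p μ) {β : ℝ} (hβ : 0 ≤ β)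
    (hβp : β < 1 / (2 * p)) :
    limsup (fun n : ℕ => (n : ℝ≥0∞) ^ β * expectedError p μ n) atTop
      ≤ ENNReal.ofReal (10 / (1 / (2 * p) - β)) *
        limsup (fun n : ℕ => (n : ℝ≥0∞) ^ β * optimalUniformError p μ n) atTop := by
  set δ : ℝ := 1 / (2 * p) - β with hδ
  have hδ0 : 0 < δ := by rw [hδ]; linarith
  set B := limsup (fun n : ℕ => (n : ℝ≥0∞) ^ β * optimalUniformError p μ n) atTop with hB
  obtain ⟨A, hA0, hA⟩ := hmoment.exists_optimalUniformError_le hp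
  by_cases hBt : B = ∞
  · rw [hBt, ENNReal.mul_top (ENNReal.ofReal_pos.2 (by positivity)).ne']
    exact le_top
  have key : ∀ C : ℝ, B.toReal < C → limsup (fun n : ℕ => (n : ℝ≥0∞) ^ β * expectedError p μ n) atTop
      ≤ ENNReal.ofReal ((19 / 2) * C / δ) := by
    intro C hC
    have hC0 : 0 ≤ C := ENNReal.toReal_nonneg.trans hC.le
    have hev := eventually_lt_of_limsup_lt ((ENNReal.lt_ofReal_iff_toReal_lt hBt).2 hC)
    obtain ⟨N, hN⟩ := eventually_atTop.1 hev
    obtain ⟨R, hR⟩ := expectedError_le_of_optimalUniformError_lt (N := N + 1) (μ := μ) hp hβ hβp hC0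
      hA0 (hA 1 one_pos) (Nat.succ_pos N)
      (fun m hm => lt_ofReal_of_rpow_mul_lt (by omega) (hN m (by omega)))
    have hlim : Tendsto (fun n : ℕ => ENNReal.ofReal ((19 / 2) * C / δ + R * (n : ℝ) ^ (-δ))) atTop
        (𝓝 (ENNReal.ofReal ((19 / 2) * C / δ + R * 0))) :=
      ENNReal.tendsto_ofReal (((tendsto_rpow_neg_atTop hδ0).comp
        tendsto_natCast_atTop_atTop).const_mul R |>.const_add _)
    rw [mul_zero, add_zero] at hlim
    rw [← hlim.limsup_eq]
    refine limsup_le_limsup ?_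
    filter_upwards [eventually_ge_atTop (N + 1)] with n hn
    have hn0 : 0 < n := by omega
    have hnR : 0 < (n : ℝ) := by exact_mod_cast hn0
    calc (n : ℝ≥0∞) ^ β * expectedError p μ n
        ≤ (n : ℝ≥0∞) ^ β * ENNReal.ofReal ((19 / 2) * C / δ * (n : ℝ) ^ (-β)
            + R * (n : ℝ) ^ (-(1 / (2 * p)))) := mul_le_mul_right (hR n hn) _
      _ = ENNReal.ofReal ((19 / 2) * C / δ + R * (n : ℝ) ^ (-δ)) := by
          rw [natCast_rpow_eq_ofReal β hn0, ← ENNReal.ofReal_mul (by positivity)]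
          congr 1
          have h1 : (n : ℝ) ^ β * (n : ℝ) ^ (-β) = 1 := by
            rw [← Real.rpow_add hnR, add_neg_cancel, Real.rpow_zero]
          have h2 : (n : ℝ) ^ (-δ) = (n : ℝ) ^ β * (n : ℝ) ^ (-(1 / (2 * p))) := by
            rw [← Real.rpow_add hnR]
            congr 1
            rw [hδ]
            ring
          rw [h2]
          linear_combination (19 / 2) * C / δ * h1
  have hlimC : Tendsto (fun C : ℝ => ENNReal.ofReal ((19 / 2) * C / δ)) (𝓝[>] B.toReal)
      (𝓝 (ENNReal.ofReal ((19 / 2) * B.toReal / δ))) := by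
    refine ENNReal.tendsto_ofReal (Tendsto.mono_left ?_ nhdsWithin_le_nhds)
    exact ((continuous_const.mul continuous_id).div_const δ).tendsto _
  refine (ge_of_tendsto hlimC (eventually_mem_nhdsWithin.mono fun C hC => key C hC)).trans ?_
  have hb := ENNReal.toReal_nonneg (a := B)
  conv_rhs => rw [← ENNReal.ofReal_toReal hBt]
  rw [← ENNReal.ofReal_mul (by positivity), div_mul_eq_mul_div 10]
  refine ENNReal.ofReal_le_ofReal (div_le_div_of_nonneg_right ?_ hδ0.le)
  linarith

theorem polynomialExponent_expectedError_le (hp : 1 ≤ p) (hmoment : HasFiniteMoment p μ) :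
    polynomialExponent (expectedError p μ) ≤ max ((-(1 / (2 * p)) : ℝ) : EReal)
      (polynomialExponent (optimalUniformError p μ)) := by
  have hp0 : 0 < p := by linarith
  refine EReal.le_of_forall_lt_iff_le.1 fun z hz => ?_
  obtain ⟨hz1, hz2⟩ := max_lt_iff.1 hz
  have hz1' : -(1 / (2 * p)) < z := by exact_mod_cast hz1
  -- For negative `z` the exponent `β = -z` is admissible. For `z ≥ 0` it would not be nonnegative
  -- in general, so `β = 0` is used, with the uniform bound coming from the finite moment.
  rcases le_or_gt 0 z with h0 | h0
  · obtain ⟨A, -, hA⟩ := hmoment.exists_optimalUniformError_le hp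
    have h1 := limsup_expectedError_le hp hmoment le_rfl (by positivity)
    refine (polynomialExponent_le_of_limsup_lt_top (β := 0) (h1.trans_lt ?_)).trans
      (by exact_mod_cast (by simpa using h0))
    refine ENNReal.mul_lt_top ENNReal.ofReal_lt_top
      ((limsup_le_of_le (a := ENNReal.ofReal A) (h := ?_)).trans_lt ENNReal.ofReal_lt_top)
    filter_upwards [eventually_gt_atTop 0] with n hn
    simpa using (hA n hn).le
  · have h1 := limsup_expectedError_le hp hmoment (β := -z) (by linarith) (by linarith)
    have h2 := limsup_rpow_mul_le_one_of_polynomialExponent_lt hz2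
    have h3 := polynomialExponent_le_of_limsup_lt_top (h1.trans_lt
      (ENNReal.mul_lt_top ENNReal.ofReal_lt_top (h2.trans_lt ENNReal.one_lt_top)))
    rwa [neg_neg] at h3

end Main

theorem mainTheorem6 {E Ω : Type*} [MetricSpace E] [TopologicalSpace.SeparableSpace E]
    [MeasurableSpace E] [BorelSpace E]
    (p : ℝ) (hp : 1 ≤ p)
    (μ : Measure E) [IsProbabilityMeasure μ]
    (hmoment : HasFiniteMoment p μ)
    (hdirac : ∀ x : E, μ ≠ Measure.dirac x)
    [MeasurableSpace Ω] (P : Measure Ω) [IsProbabilityMeasure P]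
    (X : ℕ → Ω → E) (hlaw : ∀ i, HasLaw (X i) μ P) (hindep : iIndepFun X P) :
    (max ((-(1 / 2) : ℝ) : EReal) (polynomialExponent (optimalUniformError p μ))
        ≤ polynomialExponent (empiricalError P X p μ) ∧
      polynomialExponent (empiricalError P X p μ)
        ≤ max ((-(1 / (2 * p)) : ℝ) : EReal) (polynomialExponent (optimalUniformError p μ))) ∧
    ∀ β : ℝ, 0 ≤ β → β < 1 / (2 * p) →
      limsup (fun n : ℕ => (n : ℝ≥0∞) ^ β * optimalUniformError p μ n) atTop
          ≤ limsup (fun n : ℕ => (n : ℝ≥0∞) ^ β * empiricalError P X p μ n) atTop ∧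
        limsup (fun n : ℕ => (n : ℝ≥0∞) ^ β * empiricalError P X p μ n) atTop
          ≤ ENNReal.ofReal (10 / (1 / (2 * p) - β)) *
            limsup (fun n : ℕ => (n : ℝ≥0∞) ^ β * optimalUniformError p μ n) atTop := by
  have : SecondCountableTopology E := UniformSpace.secondCountable_of_separable E
  -- Equality is needed only eventually; the index `n = 0`, where the empirical measure is zero, is
  -- irrelevant to upper limits.
  have heq : ∀ᶠ n in atTop, empiricalError P X p μ n = expectedError p μ n := by
    filter_upwards [eventually_gt_atTop 0] with n hn
    exact empiricalError_eq_expectedError hp hlaw hindep hn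
  have hexp : polynomialExponent (empiricalError P X p μ)
      = polynomialExponent (expectedError p μ) :=
    le_antisymm (polynomialExponent_mono (heq.mono fun n h => h.le))
      (polynomialExponent_mono (heq.mono fun n h => h.ge))
  have hlim : ∀ β : ℝ, limsup (fun n : ℕ => (n : ℝ≥0∞) ^ β * empiricalError P X p μ n) atTop
      = limsup (fun n : ℕ => (n : ℝ≥0∞) ^ β * expectedError p μ n) atTop := fun β =>
    limsup_congr (heq.mono fun n h => by rw [h])
  rw [hexp]
  refine ⟨⟨max_le ?_ ?_, polynomialExponent_expectedError_le hp hmoment⟩, fun β hβ hβp => ?_⟩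
  · obtain ⟨c, hc, hle⟩ := exists_le_expectedError hp hdirac
    rw [← polynomialExponent_ofReal_mul_rpow hc (-(1 / 2))]
    refine polynomialExponent_mono ?_
    filter_upwards [eventually_gt_atTop 0] with n hn using hle n hn
  · exact polynomialExponent_mono (Eventually.of_forall fun n =>
      optimalUniformError_le_expectedError hp n)
  · rw [hlim]
    refine ⟨limsup_le_limsup (Eventually.of_forall fun n => ?_),
      limsup_expectedError_le hp hmoment hβ hβp⟩
    exact mul_le_mul_right (optimalUniformError_le_expectedError hp n) _
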